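/- Let $0\le d<k\le\infty$ with $d\in\mathbb{Z}$ and $k\in\mathbb{Z}\cup\{\infty\}$. Let $S_{d,k}(n)$ be the number of binary strings of length $n$ that are concatenations of blocks from $\{0^d1,\ldots,0^k1\}$ (all $0^j1$ with $j\ge d$ if $k=\infty$), and for $j\in\{d,\ldots,k\}$, $j<\infty$, let $S^{(j)}_{d,k}(n,W,\ell)$ be the number of those that consist of exactly $W$ such blocks (equivalently, have Hamming weight $W$), exactly $\ell$ of which are $0^j1$. The equation $\sum_{i=d+1}^{k+1}x^i=1$ has a unique positive solution $\rho$; put $w^*=\bigl(\sum_{i=d+1}^{k+1} i\rho^i\bigr)^{-1}$ (the sum converges) and $\lambda_j^*=\rho^{j+1}w^*$. Logarithms are to base 2. (1) For every $j\in\{d,\ldots,k\}$, $j<\infty$, as $n\to\infty$, $$\log S_{d,k}(n)\;\sim\;\log S^{(j)}_{d,k}(n,w^*n,\lambda_j^*n),$$ where $w^*n$ and $\lambda_j^*n$ stand for integers at bounded distance from these numbers. Precisely: (a) if $W_n,\ell_n$ are nonnegative integers with $|W_n-w^*n|=\mathcal{O}(1)$, $|\ell_n-\lambda_j^*n|=\mathcal{O}(1)$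 and $S^{(j)}_{d,k}(n,W_n,\ell_n)\neq0$ for all sufficiently large $n$, then $\lim_{n\to\infty}\log S_{d,k}(n)/\log S^{(j)}_{d,k}(n,W_n,\ell_n)=1$; (b) such integers $W_n,\ell_n$ exist; (c) if $\{d,\ldots,k\}\setminus\{j\}$ contains two consecutive integers (that is, unless $k=d+1$, or $k=d+2$ and $j=d+1$), then the condition $S^{(j)}_{d,k}(n,W_n,\ell_n)\neq0$ for all large $n$ holds for all integers $W_n,\ell_n\ge 0$ with $|W_n-w^*n|=\mathcal{O}(1)$, $|\ell_n-\lambda_j^*n|=\mathcal{O}(1)$, in particular for $W_n=\lfloor w^*n\rfloor$, $\ell_n=\lfloor\lambda_j^*n\rfloor$. (2) There is a function $f$ with $f(n)=o(n)$ (depending on $d,k$ only) such that for every $j\in\{d,\ldots,k\}$, $j<\infty$, as $n\to\infty$, $$S_{d,k}(n)-\sum_{\substack{W,\ell:\ |W-w^*n|\le f(n),\\ |\ell-\lambda_j^*n|\le f(n)}}S^{(j)}_{d,k}(n,W,\ell)\;\lesssim\;\frac{S_{d,k}(n)}{n^{\log n}},$$ where $a_n\lesssim b_n$ means $\liminf_{n\to\infty}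 b_n/a_n\ge1$ (with $b_n/0=\infty$). -/

import Mathlib

open Filter Topology Asymptotics
open scoped Computability

namespace RLL

/-- The block `0^j 1`; `false` is the symbol 0 and `true` is the symbol 1. -/
def block (j : ℕ) : List Bool := List.replicate j false ++ [true]

/-- The set of blocks `{0^d 1, …, 0^k 1}`; `k = ⊤` means that all `0^j 1` with `d ≤ j` are allowed. -/
def blocks (d : ℕ) (k : ℕ∞) : Language Bool :=
  {x | ∃ j : ℕ, d ≤ j ∧ (j : ℕ∞) ≤ k ∧ x = block j}

/-- `𝒮_{d,k}(n) = {0,1}^n ∩ {0^d 1, …, 0^k 1}^*`. -/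
def strings (d : ℕ) (k : ℕ∞) (n : ℕ) : Set (List Bool) :=
  {x | x.length = n ∧ x ∈ (blocks d k)∗}

/-- `S_{d,k}(n) = |𝒮_{d,k}(n)|`. -/
noncomputable def S (d : ℕ) (k : ℕ∞) (n : ℕ) : ℕ := (strings d k n).ncard

/-- The binary strings of length `n` that are composed of exactly `W` blocks from
`{0^d 1, …, 0^k 1}`, exactly `l` of which are equal to `0^j 1`. -/
def runStrings (d : ℕ) (k : ℕ∞) (j n W l : ℕ) : Set (List Bool) :=
  {x | x.length = n ∧ ∃ L : List (List Bool), x = L.flatten ∧ (∀ y ∈ L, y ∈ blocks d k) ∧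
    L.length = W ∧ L.count (block j) = l}

/-- `S_{d,k}^{(j)}(n, W, l)`. -/
noncomputable def SRuns (d : ℕ) (k : ℕ∞) (j n W l : ℕ) : ℕ := (runStrings d k j n W l).ncard

/-- The index set `{d+1, …, k+1}` of natural numbers (infinite if `k = ⊤`). -/
def parts (d : ℕ) (k : ℕ∞) : Set ℕ := {i | d + 1 ≤ i ∧ (i : ℕ∞) ≤ k + 1}

/-- `x` is a positive solution of `∑_{i=d+1}^{k+1} x^i = 1`. -/
def IsPosRoot (d : ℕ) (k : ℕ∞) (x : ℝ) : Prop :=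
  0 < x ∧ HasSum (fun i : parts d k => x ^ (i : ℕ)) 1

/-- `w^* = (∑_{i=d+1}^{k+1} i ρ^i)⁻¹`. -/
noncomputable def wStar (d : ℕ) (k : ℕ∞) (ρ : ℝ) : ℝ :=
  (∑' i : parts d k, ((i : ℕ) : ℝ) * ρ ^ (i : ℕ))⁻¹

/-- `λ_j^* = ρ^{j+1} w^*`. -/
noncomputable def lamStar (d : ℕ) (k : ℕ∞) (ρ : ℝ) (j : ℕ) : ℝ := ρ ^ (j + 1) * wStar d k ρ

/-- `a_n ≃ b_n` on the exponential scale: `log a_n / log b_n → 1`. -/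
def SimExp (a b : ℕ → ℝ) : Prop :=
  Tendsto (fun n => Real.logb 2 (a n) / Real.logb 2 (b n)) atTop (𝓝 1)

/-- `a_n ≲ b_n` for nonnegative sequences, that is `liminf b_n / a_n ≥ 1`, written without the
division so that indices with `a_n = 0` need no convention. -/
def LessSim (a b : ℕ → ℝ) : Prop :=
  ∀ ε : ℝ, 0 < ε → ∀ᶠ n in atTop, (1 - ε) * a n ≤ b n

/-- `a n` is an integer version of the real number `c * n`, up to a bounded rounding error. -/
def IsRounding (a : ℕ → ℕ) (c : ℝ) : Prop :=
  ∃ C : ℝ, ∀ n : ℕ, |(a n : ℝ) - c * n| ≤ C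

/-- The sum of `S_{d,k}^{(j)}(n, W, l)` over all `W`, `l` with `|W - w n| ≤ r` and
`|l - v n| ≤ r` (all `W`, `l` that contribute satisfy `l ≤ W ≤ n`). -/
noncomputable def typicalCount (d : ℕ) (k : ℕ∞) (j n : ℕ) (w v r : ℝ) : ℕ :=
  ∑ p ∈ (Finset.range (n + 1) ×ˢ Finset.range (n + 1)).filter
      (fun p : ℕ × ℕ => |(p.1 : ℝ) - w * n| ≤ r ∧ |(p.2 : ℝ) - v * n| ≤ r),
    SRuns d k j n p.1 p.2

end RLL

/-! A string cut after each 1 is a composition of `n` with parts in `P = {d+1, …, k+1}`, the block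
`0^j 1` being the part `j + 1`. So `S` counts compositions, `W` is the number of parts and `l` the
multiplicity of `j + 1`.

Upper bounds. The weights `ρ^i` form a probability distribution on `P`, and the words of letter sum
`n` have total weight at most one, since the total is the probability that a renewal process hits
`n` (`sum_prod_le_one`). Each such word has weight `ρ^n`, hence `S ≤ ρ^(-n)`. Tilting the weights by
`exp (s * X i)` with `X` of negative mean keeps them sub-probabilities for small `s`
(`exists_exp_moment_le_one`). This Chernoff argument makes the compositions whose length or `j +
1`-count is off by `ε n` exponentially rarer than `ρ^(-n)`.

Lower bounds. The ideal frequencies `γ i = w* ρ^i` satisfy `∑ γ i = w*` and `∑ i γ i = 1`. With `h x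
= -x log x`, words with about `γ i * n` letters `i` number `exp (n (∑ h (γ i) - h (∑ γ i)))` up to
subexponential factors, and the exponent is exactly `-log ρ` (`hasSum_negMulLog`). If two
consecutive parts differ from `j + 1`, their counts can absorb truncation and rounding, so any `W`,
`l` within `O(1)` of the ideal values are reached. In the remaining cases `P` has two or three
elements and the linear constraints force all counts up to `O(1)`, so nonemptiness suffices
(`eventually_exp_le_SRuns_of_ne_zero`).

Thus both counts in (1) have exponential rate `-log ρ`. For (2), the exponentially small deviation
bound for each fixed `ε` is made into one `f = o(n)` by a diagonal choice. -/

namespace RLL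

/-! ### Strings as compositions -/

/-- The compositions of `n` with all parts in `{d+1, …, k+1}`. -/
def comps (d : ℕ) (k : ℕ∞) (n : ℕ) : Set (List ℕ) :=
  {L | (∀ i ∈ L, i ∈ parts d k) ∧ L.sum = n}

/-- The binary string whose successive blocks have the lengths in the list. -/
def encode (L : List ℕ) : List Bool := (L.map fun i => block (i - 1)).flatten

lemma length_block (j : ℕ) : (block j).length = j + 1 := by simp [block]

lemma block_injective : Function.Injective block := fun a b h => by
  have := congrArg List.length h
  simpa [length_block] using this

lemma parts_pos {d : ℕ} {k : ℕ∞} {i : ℕ} (h : i ∈ parts d k) : 0 < i := by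
  have := h.1; omega

lemma succ_mem_parts {d : ℕ} {k : ℕ∞} {j : ℕ} :
    j + 1 ∈ parts d k ↔ d ≤ j ∧ (j : ℕ∞) ≤ k := by
  change d + 1 ≤ j + 1 ∧ ((j + 1 : ℕ) : ℕ∞) ≤ k + 1 ↔ _
  rw [Nat.cast_add, Nat.cast_one, ENat.add_le_add_iff_right (by simp), add_le_add_iff_right]

lemma mem_blocks_iff {d : ℕ} {k : ℕ∞} {y : List Bool} :
    y ∈ blocks d k ↔ ∃ i ∈ parts d k, y = block (i - 1) := by
  constructor
  · rintro ⟨j, h1, h2, rfl⟩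
    exact ⟨j + 1, succ_mem_parts.2 ⟨h1, h2⟩, by simp⟩
  · rintro ⟨i, hi, rfl⟩
    obtain ⟨j, rfl⟩ := Nat.exists_eq_succ_of_ne_zero (parts_pos hi).ne'
    obtain ⟨h1, h2⟩ := succ_mem_parts.1 hi
    exact ⟨j, h1, h2, by simp⟩

lemma length_encode {L : List ℕ} (h : ∀ i ∈ L, 0 < i) : (encode L).length = L.sum := by
  induction L with
  | nil => simp [encode]
  | cons a L ih =>
    have := ih fun i hi => h i (by simp [hi])
    have ha := h a (by simp)
    simp only [encode, List.map_cons, List.flatten_cons, List.length_append, length_block,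
      List.sum_cons] at this ⊢
    omega

/-- The first 1 marks the end of the first block: the blocks form a prefix code, so parsing is
unique. -/
lemma block_append_cancel {a b : ℕ} {x y : List Bool} (h : block a ++ x = block b ++ y) :
    a = b ∧ x = y := by
  induction a generalizing b with
  | zero =>
    cases b with
    | zero => simpa [block] using h
    | succ b => simp [block, List.replicate_succ] at h
  | succ a ih =>
    cases b with
    | zero => simp [block, List.replicate_succ] at h
    | succ b =>
      have : block a ++ x = block b ++ y := by
        simpa [block, List.replicate_succ] using h
      simpa using ih this

/-- Positivity matters because `i - 1` is truncated: the parts 0 and 1 would give the same block. -/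
lemma encode_inj {L M : List ℕ} (hL : ∀ i ∈ L, 0 < i) (hM : ∀ i ∈ M, 0 < i)
    (h : encode L = encode M) : L = M := by
  induction L generalizing M with
  | nil =>
    cases M with
    | nil => rfl
    | cons b M => simp [encode, block] at h
  | cons a L ih =>
    cases M with
    | nil => simp [encode, block] at h
    | cons b M =>
      simp only [encode, List.map_cons, List.flatten_cons] at h
      obtain ⟨h1, h2⟩ := block_append_cancel h
      have ha := hL a (by simp)
      have hb := hM b (by simp)
      rw [ih (fun i hi => hL i (by simp [hi])) (fun i hi => hM i (by simp [hi])) h2]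
      congr 1
      omega

lemma encode_injOn (d : ℕ) (k : ℕ∞) (n : ℕ) : Set.InjOn encode (comps d k n) :=
  fun _ hL _ hM h => encode_inj (fun i hi => parts_pos (hL.1 i hi))
    (fun i hi => parts_pos (hM.1 i hi)) h

lemma exists_map_block {d : ℕ} {k : ℕ∞} {L : List (List Bool)} (h : ∀ y ∈ L, y ∈ blocks d k) :
    ∃ M : List ℕ, (∀ i ∈ M, i ∈ parts d k) ∧ L = M.map fun i => block (i - 1) := by
  induction L with
  | nil => exact ⟨[], by simp⟩
  | cons a L ih =>
    obtain ⟨M, h1, rfl⟩ := ih fun y hy => h y (by simp [hy])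
    obtain ⟨i, hi, rfl⟩ := mem_blocks_iff.1 (h a (by simp))
    exact ⟨i :: M, by simpa using ⟨hi, h1⟩, by simp⟩

lemma strings_eq (d : ℕ) (k : ℕ∞) (n : ℕ) : strings d k n = encode '' comps d k n := by
  ext x
  constructor
  · rintro ⟨hx, hk⟩
    obtain ⟨L, rfl, hL⟩ := Language.mem_kstar.1 hk
    obtain ⟨M, h1, rfl⟩ := exists_map_block hL
    refine ⟨M, ⟨h1, ?_⟩, rfl⟩
    rw [← hx]
    exact (length_encode fun i hi => parts_pos (h1 i hi)).symm
  · rintro ⟨M, ⟨h1, h2⟩, rfl⟩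
    refine ⟨by rw [length_encode fun i hi => parts_pos (h1 i hi), h2],
      Language.mem_kstar.2 ⟨_, rfl, ?_⟩⟩
    intro y hy
    obtain ⟨i, hi, rfl⟩ := List.mem_map.1 hy
    exact mem_blocks_iff.2 ⟨i, h1 i hi, rfl⟩

lemma count_map_block {L : List ℕ} (hL : ∀ i ∈ L, 0 < i) (j : ℕ) :
    (L.map fun i => block (i - 1)).count (block j) = L.count (j + 1) := by
  induction L with
  | nil => simp
  | cons a L ih =>
    have ha := hL a (by simp)
    rw [List.map_cons, List.count_cons, List.count_cons, ih fun i hi => hL i (by simp [hi])]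
    congr 1
    simp only [beq_iff_eq, block_injective.eq_iff]
    congr 1
    simp only [eq_iff_iff]
    omega

lemma runStrings_eq (d : ℕ) (k : ℕ∞) (j n W l : ℕ) : runStrings d k j n W l =
    encode '' {L | L ∈ comps d k n ∧ L.length = W ∧ L.count (j + 1) = l} := by
  ext x
  constructor
  · rintro ⟨hx, L, rfl, hL, hW, hl⟩
    obtain ⟨M, h1, rfl⟩ := exists_map_block hL
    refine ⟨M, ⟨⟨h1, ?_⟩, by simpa using hW, ?_⟩, rfl⟩
    · rw [← hx]
      exact (length_encode fun i hi => parts_pos (h1 i hi)).symm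
    · rw [← hl, count_map_block fun i hi => parts_pos (h1 i hi)]
  · rintro ⟨M, ⟨⟨h1, h2⟩, hW, hl⟩, rfl⟩
    refine ⟨by rw [length_encode fun i hi => parts_pos (h1 i hi), h2], _, rfl, ?_, by simpa, ?_⟩
    · intro y hy
      obtain ⟨i, hi, rfl⟩ := List.mem_map.1 hy
      exact mem_blocks_iff.2 ⟨i, h1 i hi, rfl⟩
    · rw [← hl, count_map_block fun i hi => parts_pos (h1 i hi)]

lemma S_eq_ncard (d : ℕ) (k : ℕ∞) (n : ℕ) : S d k n = (comps d k n).ncard := by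
  rw [S, strings_eq, (encode_injOn d k n).ncard_image]

lemma SRuns_eq_ncard (d : ℕ) (k : ℕ∞) (j n W l : ℕ) : SRuns d k j n W l =
    {L | L ∈ comps d k n ∧ L.length = W ∧ L.count (j + 1) = l}.ncard := by
  rw [SRuns, runStrings_eq, ((encode_injOn d k n).mono fun _ h => h.1).ncard_image]

lemma comps_finite (d : ℕ) (k : ℕ∞) (n : ℕ) : (comps d k n).Finite := by
  refine Set.Finite.of_finite_image ?_ (encode_injOn d k n)
  rw [← strings_eq]
  exact (List.finite_length_eq Bool n).subset fun x hx => hx.1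

lemma length_le_of_mem_comps {d : ℕ} {k : ℕ∞} {n : ℕ} {L : List ℕ} (h : L ∈ comps d k n) :
    L.length ≤ n := by
  rw [← h.2]
  have : ∀ M : List ℕ, (∀ i ∈ M, 0 < i) → M.length ≤ M.sum := fun M hM => by
    induction M with
    | nil => simp
    | cons a M ih =>
      have := ih fun i hi => hM i (by simp [hi])
      have ha := hM a (by simp)
      simp only [List.length_cons, List.sum_cons]
      omega
  exact this L fun i hi => parts_pos (h.1 i hi)

/-! ### Words with prescribed letter counts -/

/-- There are at least `(∑ c)! / ∏ c!` words over `F` with letter counts `c`. -/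
lemma exists_finset_count_eq (F : Finset ℕ) (W : ℕ) (c : ℕ → ℕ) (hc : ∑ i ∈ F, c i = W) :
    ∃ A : Finset (List ℕ), (∀ L ∈ A, (∀ i ∈ L, i ∈ F) ∧ ∀ i ∈ F, L.count i = c i) ∧
      W.factorial ≤ A.card * ∏ i ∈ F, (c i).factorial := by
  induction W generalizing c with
  | zero =>
    have h0 : ∀ i ∈ F, c i = 0 := by simpa [Finset.sum_eq_zero_iff] using hc
    refine ⟨{[]}, by simpa using fun i hi => (h0 i hi).symm, ?_⟩
    rw [Finset.prod_congr rfl fun i hi => by rw [h0 i hi]]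
    simp
  | succ W ih =>
    -- Words are sorted by first letter: deleting a leading `a` lowers `c a` by one, and `∑ c a * W!
    -- = (W + 1)!`. The hypotheses on `a` sit inside the existential so that `choose` yields a total
    -- function.
    have key : ∀ a : ℕ, ∃ A : Finset (List ℕ), a ∈ F → 0 < c a →
        (∀ L ∈ A, (∀ i ∈ L, i ∈ F) ∧ ∀ i ∈ F, L.count i = Function.update c a (c a - 1) i) ∧
        W.factorial ≤ A.card * ∏ i ∈ F, (Function.update c a (c a - 1) i).factorial := by
      intro a
      by_cases ha : a ∈ F ∧ 0 < c a
      · obtain ⟨A, hA⟩ := ih (Function.update c a (c a - 1)) (by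
          rw [Finset.sum_update_of_mem ha.1]
          rw [← Finset.add_sum_erase _ _ ha.1, Finset.erase_eq] at hc
          omega)
        exact ⟨A, fun _ _ => hA⟩
      · exact ⟨∅, fun h1 h2 => absurd ⟨h1, h2⟩ ha⟩
    choose A hA using key
    have hdisj : (↑(F.filter fun a => 0 < c a) : Set ℕ).PairwiseDisjoint
        fun a => (A a).map ⟨List.cons a, List.cons_injective⟩ := by
      intro a _ b _ hab
      simp only [Function.onFun]
      rw [Finset.disjoint_left]
      rintro L h1 h2
      simp only [Finset.mem_map, Function.Embedding.coeFn_mk] at h1 h2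
      obtain ⟨L1, -, rfl⟩ := h1
      obtain ⟨L2, -, h⟩ := h2
      exact hab (List.cons.inj h).1.symm
    refine ⟨(F.filter fun a => 0 < c a).disjiUnion
      (fun a => (A a).map ⟨List.cons a, List.cons_injective⟩) hdisj, ?_, ?_⟩
    · intro L hL
      simp only [Finset.mem_disjiUnion, Finset.mem_filter, Finset.mem_map,
        Function.Embedding.coeFn_mk] at hL
      obtain ⟨a, ⟨haF, hac⟩, M, hM, rfl⟩ := hL
      obtain ⟨h1, h2⟩ := (hA a haF hac).1 M hM
      refine ⟨by simpa using ⟨haF, h1⟩, fun i hi => ?_⟩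
      rw [List.count_cons, h2 i hi]
      by_cases h : a = i
      · subst h; simp; omega
      · simp [h, Function.update_of_ne (Ne.symm h)]
    · rw [Finset.card_disjiUnion, Finset.sum_mul]
      simp only [Finset.card_map]
      have hprod : ∀ a ∈ F.filter (fun a => 0 < c a), ∏ i ∈ F, (c i).factorial =
          c a * ∏ i ∈ F, (Function.update c a (c a - 1) i).factorial := by
        intro a ha
        obtain ⟨ha1, ha2⟩ := Finset.mem_filter.1 ha
        rw [← Finset.mul_prod_erase F _ ha1, ← Finset.mul_prod_erase F (fun i =>
          (Function.update c a (c a - 1) i).factorial) ha1, ← mul_assoc]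
        congr 1
        · simp [Nat.mul_factorial_pred ha2.ne']
        · refine Finset.prod_congr rfl fun i hi => ?_
          rw [Function.update_of_ne (Finset.ne_of_mem_erase hi)]
      calc (W + 1).factorial = ∑ a ∈ F.filter (fun a => 0 < c a), c a * W.factorial := by
            rw [Nat.factorial_succ, ← hc, ← Finset.sum_mul]
            congr 1
            symm
            refine Finset.sum_filter_of_ne fun a _ h => Nat.pos_of_ne_zero h
        _ ≤ _ := by
            refine Finset.sum_le_sum fun a ha => ?_
            rw [hprod a ha]
            obtain ⟨ha1, ha2⟩ := Finset.mem_filter.1 ha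
            calc c a * W.factorial ≤ c a * _ := Nat.mul_le_mul_left _ (hA a ha1 ha2).2
              _ = _ := by ring

/-! ### The root `ρ` and the mean part length -/

lemma isPosRoot_iff {d : ℕ} {k : ℕ∞} {x : ℝ} :
    IsPosRoot d k x ↔ 0 < x ∧ HasSum ((parts d k).indicator fun i => x ^ i) 1 := by
  rw [← hasSum_subtype_iff_indicator]
  rfl

lemma parts_natCast (d m : ℕ) : parts d m = ↑(Finset.Icc (d + 1) (m + 1)) := by
  ext i
  rw [Finset.coe_Icc, Set.mem_Icc]
  change _ ∧ (i : ℕ∞) ≤ m + 1 ↔ _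
  norm_cast

lemma add_one_mem_parts {d : ℕ} {k : ℕ∞} (hdk : (d : ℕ∞) < k) : d + 1 ∈ parts d k :=
  succ_mem_parts.2 ⟨le_rfl, hdk.le⟩

lemma add_two_mem_parts {d : ℕ} {k : ℕ∞} (hdk : (d : ℕ∞) < k) : d + 1 + 1 ∈ parts d k :=
  succ_mem_parts.2 ⟨by omega, by simpa using Order.add_one_le_of_lt hdk⟩

lemma IsPosRoot.not_lt {d : ℕ} {k : ℕ∞} (hdk : (d : ℕ∞) < k) {x y : ℝ} (hx : IsPosRoot d k x)
    (hy : IsPosRoot d k y) : ¬ x < y := fun h =>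
  lt_irrefl _ (hasSum_lt (i := ⟨d + 1, add_one_mem_parts hdk⟩)
    (fun i : parts d k => pow_le_pow_left₀ hx.1.le h.le i)
    (pow_lt_pow_left₀ h hx.1.le (by simp)) hx.2 hy.2)

lemma IsPosRoot.unique {d : ℕ} {k : ℕ∞} (hdk : (d : ℕ∞) < k) {x y : ℝ} (hx : IsPosRoot d k x)
    (hy : IsPosRoot d k y) : x = y :=
  le_antisymm (_root_.not_lt.1 (IsPosRoot.not_lt hdk hy hx))
    (_root_.not_lt.1 (IsPosRoot.not_lt hdk hx hy))

/-- Intermediate value theorem on `[0, 1]`. For `k = ∞` the geometric series turns the equation into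
`x^(d+1) + x = 1`. -/
lemma exists_isPosRoot {d : ℕ} {k : ℕ∞} (hdk : (d : ℕ∞) < k) : ∃ x, IsPosRoot d k x := by
  induction k using ENat.recTopCoe with
  | top =>
    have hc : ContinuousOn (fun x : ℝ => x ^ (d + 1) + x) (Set.Icc 0 1) := by fun_prop
    obtain ⟨x, ⟨hx0, hx1⟩, hx⟩ := intermediate_value_Icc (by norm_num) hc
      (show (1 : ℝ) ∈ _ by simp)
    simp only at hx
    have hx0' : 0 < x := by
      rcases hx0.eq_or_lt with rfl | h
      · simp at hx
      · exact h
    have hpos : 0 < x ^ (d + 1) := by positivity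
    have hx1' : x < 1 := by linarith
    refine ⟨x, isPosRoot_iff.2 ⟨hx0', ?_⟩⟩
    have hmem : ∀ i, i ∈ parts d ⊤ ↔ d + 1 ≤ i := fun i => ⟨fun h => h.1, fun h => ⟨h, by simp⟩⟩
    rw [← hasSum_nat_add_iff' (d + 1), Finset.sum_eq_zero, sub_zero]
    · have := (hasSum_geometric_of_lt_one hx0 hx1').mul_left (x ^ (d + 1))
      rw [show x ^ (d + 1) = 1 - x by linarith, mul_inv_cancel₀ (by linarith)] at this
      refine this.congr_fun fun i => ?_
      rw [Set.indicator_of_mem ((hmem _).2 (by omega)), pow_add, show x ^ (d + 1) = 1 - x by linarith]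
      ring
    · intro i hi
      rw [Set.indicator_of_notMem]
      rw [hmem]
      have := Finset.mem_range.1 hi
      omega
  | coe m =>
    have hdm : d < m := by exact_mod_cast hdk
    have hc : ContinuousOn (fun x : ℝ => ∑ i ∈ Finset.Icc (d + 1) (m + 1), x ^ i) (Set.Icc 0 1) := by
      fun_prop
    obtain ⟨x, ⟨hx0, hx1⟩, hx⟩ := intermediate_value_Icc (by norm_num) hc
      (show (1 : ℝ) ∈ _ by
        constructor
        · rw [Finset.sum_eq_zero]
          · norm_num
          · intro i hi
            have := Finset.mem_Icc.1 hi
            exact zero_pow (by omega)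
        · simp only [one_pow, Finset.sum_const, Nat.card_Icc, nsmul_eq_mul, mul_one]
          exact_mod_cast (by omega : 1 ≤ m + 1 + 1 - (d + 1)))
    simp only at hx
    have hx0' : 0 < x := by
      rcases hx0.eq_or_lt with rfl | h
      · rw [Finset.sum_eq_zero] at hx
        · simp at hx
        · intro i hi
          have := Finset.mem_Icc.1 hi
          exact zero_pow (by omega)
      · exact h
    refine ⟨x, isPosRoot_iff.2 ⟨hx0', ?_⟩⟩
    rw [parts_natCast, ← hx, ← hasSum_subtype_iff_indicator]
    exact Finset.hasSum _ _

section root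

variable {d : ℕ} {k : ℕ∞} {ρ : ℝ}

lemma IsPosRoot.hasSum (hρ : IsPosRoot d k ρ) :
    HasSum ((parts d k).indicator fun i => ρ ^ i) 1 := (isPosRoot_iff.1 hρ).2

/-- Since `d < k` there are at least two parts, and `ρ ≥ 1` would make their terms alone sum to 2.
-/
lemma IsPosRoot.lt_one (hdk : (d : ℕ∞) < k) (hρ : IsPosRoot d k ρ) : ρ < 1 := by
  by_contra! h
  have h1 := sum_le_hasSum {d + 1, d + 1 + 1}
    (fun i _ => Set.indicator_nonneg (fun i _ => (pow_pos hρ.1 i).le) i) hρ.hasSum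
  rw [Finset.sum_pair (by omega), Set.indicator_of_mem (add_one_mem_parts hdk),
    Set.indicator_of_mem (add_two_mem_parts hdk)] at h1
  have h2 := one_le_pow₀ h (n := d + 1)
  have h3 := one_le_pow₀ h (n := d + 1 + 1)
  linarith

lemma IsPosRoot.summable_mul (hdk : (d : ℕ∞) < k) (hρ : IsPosRoot d k ρ) :
    Summable ((parts d k).indicator fun i => (i : ℝ) * ρ ^ i) := by
  refine Summable.indicator ?_ _
  simpa using summable_pow_mul_geometric_of_norm_lt_one 1 (r := ρ)
    (by rw [Real.norm_eq_abs, abs_of_pos hρ.1]; exact hρ.lt_one hdk)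

lemma wStar_eq : wStar d k ρ = (∑' i, (parts d k).indicator (fun i => (i : ℝ) * ρ ^ i) i)⁻¹ := by
  rw [wStar, ← tsum_subtype]

lemma IsPosRoot.mean_pos (hdk : (d : ℕ∞) < k) (hρ : IsPosRoot d k ρ) :
    0 < ∑' i, (parts d k).indicator (fun i => (i : ℝ) * ρ ^ i) i := by
  refine (hρ.summable_mul hdk).tsum_pos
    (fun i => Set.indicator_nonneg (fun i _ => mul_nonneg i.cast_nonneg (pow_pos hρ.1 i).le) i)
    (d + 1) ?_
  rw [Set.indicator_of_mem (add_one_mem_parts hdk)]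
  have := pow_pos hρ.1 (d + 1)
  positivity

lemma IsPosRoot.wStar_pos (hdk : (d : ℕ∞) < k) (hρ : IsPosRoot d k ρ) : 0 < wStar d k ρ := by
  rw [wStar_eq]
  exact inv_pos.2 (hρ.mean_pos hdk)

lemma IsPosRoot.hasSum_mul (hdk : (d : ℕ∞) < k) (hρ : IsPosRoot d k ρ) :
    HasSum ((parts d k).indicator fun i => (i : ℝ) * ρ ^ i) (wStar d k ρ)⁻¹ := by
  rw [wStar_eq, inv_inv]
  exact (hρ.summable_mul hdk).hasSum

end root

/-! ### Upper bounds by sub-probability weights -/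

/-- The words with letter sum `n` have total weight at most one under a sub-probability weight. -/
lemma sum_prod_le_one (q : ℕ → ℝ) (hq0 : ∀ i, 0 ≤ q i)
    (hq : ∀ n, ∑ i ∈ Finset.Icc 1 n, q i ≤ 1) (n : ℕ) (A : Finset (List ℕ))
    (hA : ∀ L ∈ A, (∀ i ∈ L, 0 < i) ∧ L.sum = n) : ∑ L ∈ A, (L.map q).prod ≤ 1 := by
  induction n using Nat.strong_induction_on generalizing A with
  | _ n ih =>
  rcases Nat.eq_zero_or_pos n with rfl | hn
  · have : A ⊆ {[]} := fun L hL => by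
      obtain ⟨h1, h2⟩ := hA L hL
      rw [List.sum_eq_zero_iff] at h2
      cases L with
      | nil => simp
      | cons a L => have := h1 a (by simp); have := h2 a (by simp); omega
    calc ∑ L ∈ A, (L.map q).prod ≤ ∑ L ∈ {[]}, (L.map q).prod :=
          Finset.sum_le_sum_of_subset_of_nonneg this fun L hL _ => by
            rw [Finset.mem_singleton.1 hL]; simp
      _ ≤ 1 := by simp
  · have hcons : ∀ L ∈ A, ∃ M, L = L.headI :: M := fun L hL => by
      cases L with
      | nil => have := (hA _ hL).2; simp at this; omega
      | cons a M => exact ⟨M, rfl⟩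
    have hmem : ∀ L ∈ A, L.headI ∈ Finset.Icc 1 n := fun L hL => by
      obtain ⟨M, hM⟩ := hcons L hL
      obtain ⟨h1, h2⟩ := hA L hL
      rw [hM] at h1 h2
      have := h1 L.headI (by simp)
      rw [List.sum_cons] at h2
      exact Finset.mem_Icc.2 ⟨this, by omega⟩
    -- Split by the first letter `a`: it contributes the factor `q a`, and the tails have letter sum
    -- `n - a`.
    rw [← Finset.sum_fiberwise_of_maps_to hmem]
    refine le_trans (Finset.sum_le_sum fun a ha => ?_) (hq n)
    have hinj : Set.InjOn (List.cons a) (List.cons a ⁻¹' ↑A) := (List.cons_injective).injOn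
    have hB : (A.filter fun L => L.headI = a) =
        (A.preimage (List.cons a) hinj).map ⟨List.cons a, List.cons_injective⟩ := by
      ext L
      simp only [Finset.mem_filter, Finset.mem_map, Finset.mem_preimage, Function.Embedding.coeFn_mk]
      constructor
      · rintro ⟨hL, rfl⟩
        obtain ⟨M, hM⟩ := hcons L hL
        exact ⟨M, hM ▸ hL, hM.symm⟩
      · rintro ⟨M, hM, rfl⟩
        exact ⟨hM, rfl⟩
    rw [hB, Finset.sum_map]
    simp only [Function.Embedding.coeFn_mk, List.map_cons, List.prod_cons]
    rw [← Finset.mul_sum]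
    have ha' := Finset.mem_Icc.1 ha
    refine mul_le_of_le_one_right (hq0 a) (ih (n - a) (by omega) _ fun M hM => ?_)
    obtain ⟨h1, h2⟩ := hA _ (Finset.mem_preimage.1 hM)
    rw [List.sum_cons] at h2
    exact ⟨fun i hi => h1 i (by simp [hi]), by omega⟩

/-- A variable of negative mean has an exponential moment at most one. -/
lemma exists_exp_moment_le_one {P : Set ℕ} {ρ : ℝ} (hρ0 : 0 < ρ) (hρ1 : ρ < 1)
    (h1 : HasSum (P.indicator fun i => ρ ^ i) 1) {X : ℕ → ℝ} {C m : ℝ}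
    (hC : 0 < C) (hX : ∀ i ∈ P, |X i| ≤ C * i)
    (hm : HasSum (P.indicator fun i => X i * ρ ^ i) m) (hm0 : m < 0) :
    ∃ s : ℝ, 0 < s ∧ ∀ n, ∑ i ∈ Finset.Icc 1 n,
      P.indicator (fun i => ρ ^ i * Real.exp (s * X i)) i ≤ 1 := by
  have hlog : Real.log ρ < 0 := Real.log_neg hρ0 hρ1
  -- This choice makes `r = ρ^(1/2) < 1`, so that `B`, the bound for the second-order term, is
  -- finite.
  set s₀ := -Real.log ρ / (2 * C) with hs₀
  have hs₀pos : 0 < s₀ := div_pos (by linarith) (by positivity)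
  set r := Real.exp (s₀ * C) * ρ with hr
  have hr0 : 0 < r := by positivity
  have hr1 : r < 1 := by
    rw [hr, ← Real.exp_log hρ0, ← Real.exp_add, Real.exp_lt_one_iff,
      show s₀ * C = -Real.log ρ / 2 by rw [hs₀]; field_simp]
    linarith
  have hB := (summable_pow_mul_geometric_of_norm_lt_one 2 (r := r)
    (by rw [Real.norm_eq_abs, abs_of_pos hr0]; exact hr1)).mul_left (C ^ 2)
  set B := ∑' i : ℕ, C ^ 2 * ((i : ℝ) ^ 2 * r ^ i) with hBdef
  have hB0 : 0 ≤ B := tsum_nonneg fun i => by positivity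
  set s := min s₀ (-m / (B + 1)) with hs
  have hs0 : 0 < s := lt_min hs₀pos (div_pos (by linarith) (by linarith))
  have hsm : m + s * B ≤ 0 := by
    have : s * (B + 1) ≤ -m := by
      rw [← le_div_iff₀ (by linarith)]
      exact min_le_right _ _
    linarith
  refine ⟨s, hs0, fun n => ?_⟩
  have hg := (h1.add (hm.mul_left s)).add (hB.hasSum.mul_left (s ^ 2))
  have hle : ∀ i, P.indicator (fun i => ρ ^ i * Real.exp (s * X i)) i ≤
      P.indicator (fun i => ρ ^ i) i + s * P.indicator (fun i => X i * ρ ^ i) i +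
        s ^ 2 * (C ^ 2 * ((i : ℝ) ^ 2 * r ^ i)) := by
    intro i
    by_cases hi : i ∈ P
    · simp only [Set.indicator_of_mem hi]
      -- Taylor bound `exp x ≤ 1 + x + x² exp |x|`. Summed against `ρ^i` it gives `1 + s m + s² B`,
      -- at most 1 by `hsm`.
      have hbound : Real.exp (s * X i) ≤ 1 + s * X i +
          (s * (C * i)) ^ 2 * Real.exp (s₀ * (C * i)) := by
        have h := Complex.norm_exp_sub_sum_le_norm_mul_exp (s * X i : ℝ) 2
        rw [Finset.sum_range_succ, Finset.sum_range_one] at h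
        simp only [pow_zero, Nat.factorial_zero, pow_one, Nat.factorial_one, Nat.cast_one,
          div_one] at h
        rw [← Complex.ofReal_exp, ← Complex.ofReal_one, ← Complex.ofReal_add, ← Complex.ofReal_sub,
          Complex.norm_real, Complex.norm_real, Real.norm_eq_abs, Real.norm_eq_abs] at h
        have h2 := (abs_le.1 h).2
        have h3 : |s * X i| ≤ s * (C * i) := by
          rw [abs_mul, abs_of_pos hs0]
          exact mul_le_mul_of_nonneg_left (hX i hi) hs0.le
        have h4 : s * (C * i) ≤ s₀ * (C * i) :=
          mul_le_mul_of_nonneg_right (min_le_left _ _) (by positivity)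
        have h5 : |s * X i| ^ 2 * Real.exp |s * X i| ≤
            (s * (C * i)) ^ 2 * Real.exp (s₀ * (C * i)) := by
          gcongr
          exact h3.trans h4
        linarith
      have hri : r ^ i = Real.exp (s₀ * (C * i)) * ρ ^ i := by
        rw [hr, mul_pow, ← Real.exp_nat_mul]
        ring_nf
      calc ρ ^ i * Real.exp (s * X i) ≤ ρ ^ i * (1 + s * X i +
          (s * (C * i)) ^ 2 * Real.exp (s₀ * (C * i))) := by gcongr
        _ = _ := by rw [hri]; ring
    · simp only [Set.indicator_of_notMem hi]
      positivity
  have hnn : ∀ i, 0 ≤ P.indicator (fun i => ρ ^ i * Real.exp (s * X i)) i := fun i =>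
    Set.indicator_nonneg (fun i _ => by positivity) i
  have hsum : Summable (P.indicator fun i => ρ ^ i * Real.exp (s * X i)) :=
    Summable.of_nonneg_of_le hnn hle hg.summable
  calc _ ≤ ∑' i, P.indicator (fun i => ρ ^ i * Real.exp (s * X i)) i :=
        hsum.sum_le_tsum _ fun i _ => hnn i
    _ ≤ 1 + s * m + s ^ 2 * B := hasSum_le hle hsum.hasSum hg
    _ ≤ 1 := by nlinarith

section upper

variable {d : ℕ} {k : ℕ∞} {ρ : ℝ}

/-- Every composition of `n` has the same weight `ρ^n`, and the total weight is at most one. -/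
lemma card_le_inv_pow (hρ : IsPosRoot d k ρ) {n : ℕ} {A : Finset (List ℕ)}
    (hA : ∀ L ∈ A, L ∈ comps d k n) : (A.card : ℝ) ≤ (ρ ^ n)⁻¹ := by
  have hnn : ∀ i, 0 ≤ (parts d k).indicator (fun i => ρ ^ i) i := fun i =>
    Set.indicator_nonneg (fun i _ => (pow_pos hρ.1 i).le) i
  have h := sum_prod_le_one _ hnn (fun m => sum_le_hasSum _ (fun i _ => hnn i) hρ.hasSum) n A
    fun L hL => ⟨fun i hi => parts_pos ((hA L hL).1 i hi), (hA L hL).2⟩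
  have hprod : ∀ L : List ℕ, (∀ i ∈ L, i ∈ parts d k) →
      (L.map ((parts d k).indicator fun i => ρ ^ i)).prod = ρ ^ L.sum := fun L => by
    induction L with
    | nil => simp
    | cons a L ih =>
      intro hL
      rw [List.map_cons, List.prod_cons, ih fun i hi => hL i (by simp [hi]),
        Set.indicator_of_mem (hL a (by simp)), List.sum_cons, pow_add]
  rw [Finset.sum_congr rfl fun L hL => by rw [hprod L (hA L hL).1, (hA L hL).2],
    Finset.sum_const, nsmul_eq_mul] at h
  rwa [← one_div, le_div_iff₀ (pow_pos hρ.1 n)]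

/-- Chernoff bound. The mean of `a` under `ρ^i` is `v` times the mean part length, so `v n` is the
typical value of the additive statistic. -/
lemma card_le_exp_of_le_sum (hdk : (d : ℕ∞) < k) (hρ : IsPosRoot d k ρ) {a : ℕ → ℝ}
    (ha : ∀ i, |a i| ≤ 1) {v : ℝ}
    (hv : HasSum ((parts d k).indicator fun i => a i * ρ ^ i) (v * (wStar d k ρ)⁻¹))
    {ε : ℝ} (hε : 0 < ε) : ∃ s : ℝ, 0 < s ∧ ∀ (n : ℕ) (A : Finset (List ℕ)),
      (∀ L ∈ A, L ∈ comps d k n ∧ ε * n ≤ (L.map a).sum - v * n) →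
      (A.card : ℝ) ≤ Real.exp (-(s * n)) * (ρ ^ n)⁻¹ := by
  have hw := hρ.wStar_pos hdk
  -- Half of `ε` makes the mean of `X` negative; the other half leaves `∑ X ≥ ε n / 2` on every
  -- counted composition.
  set X : ℕ → ℝ := fun i => a i - i * (v + ε / 2) with hXdef
  obtain ⟨s, hs, hsum⟩ := exists_exp_moment_le_one (X := X) (C := 1 + |v + ε / 2|)
    (m := v * (wStar d k ρ)⁻¹ - (v + ε / 2) * (wStar d k ρ)⁻¹)
    hρ.1 (hρ.lt_one hdk) hρ.hasSum (by positivity)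
    (fun i hi => by
      have h1 : (1 : ℝ) ≤ i := by exact_mod_cast parts_pos hi
      calc |X i| ≤ |a i| + |i * (v + ε / 2)| := abs_sub _ _
        _ ≤ 1 * i + |v + ε / 2| * i := by
          rw [abs_mul, Nat.abs_cast, mul_comm (i : ℝ)]
          have := ha i
          gcongr
          linarith
        _ = _ := by ring)
    (by
      refine (hv.sub ((hρ.hasSum_mul hdk).mul_left (v + ε / 2))).congr_fun fun i => ?_
      by_cases hi : i ∈ parts d k
      · simp only [Set.indicator_of_mem hi, hXdef]; ring
      · simp [Set.indicator_of_notMem hi])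
    (by
      have := inv_pos.2 hw
      nlinarith [mul_pos hε this])
  refine ⟨s * ε / 2, by positivity, fun n A hA => ?_⟩
  set q := (parts d k).indicator fun i => ρ ^ i * Real.exp (s * X i) with hq
  have h := sum_prod_le_one q (fun i => Set.indicator_nonneg
    (fun i _ => mul_nonneg (pow_pos hρ.1 i).le (Real.exp_pos _).le) i) hsum n A
    fun L hL => ⟨fun i hi => parts_pos ((hA L hL).1.1 i hi), (hA L hL).1.2⟩
  have hprod : ∀ L : List ℕ, (∀ i ∈ L, i ∈ parts d k) → (L.map q).prod =
      ρ ^ L.sum * Real.exp (s * ((L.map a).sum - L.sum * (v + ε / 2))) := fun L => by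
    induction L with
    | nil => simp
    | cons b L ih =>
      intro hL
      rw [List.map_cons, List.prod_cons, ih fun i hi => hL i (by simp [hi]), hq,
        Set.indicator_of_mem (hL b (by simp)), List.sum_cons, pow_add, List.map_cons,
        List.sum_cons, mul_mul_mul_comm, ← Real.exp_add]
      congr 2
      simp only [hXdef]
      push_cast
      ring
  have hle : ∀ L ∈ A, ρ ^ n * Real.exp (s * ε / 2 * n) ≤ (L.map q).prod := by
    intro L hL
    obtain ⟨⟨h1, h2⟩, h3⟩ := hA L hL
    rw [hprod L h1, h2]
    have hpos := (pow_pos hρ.1 n).le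
    rw [show s * ε / 2 * n = s * (ε / 2 * n) by ring]
    gcongr
    linarith
  have h' := (Finset.sum_le_sum hle).trans h
  rw [Finset.sum_const, nsmul_eq_mul] at h'
  rw [Real.exp_neg, ← mul_inv, ← one_div, le_div_iff₀ (mul_pos (Real.exp_pos _) (pow_pos hρ.1 n))]
  linarith

lemma card_le_exp_of_le_abs_sum (hdk : (d : ℕ∞) < k) (hρ : IsPosRoot d k ρ) {a : ℕ → ℝ}
    (ha : ∀ i, |a i| ≤ 1) {v : ℝ}
    (hv : HasSum ((parts d k).indicator fun i => a i * ρ ^ i) (v * (wStar d k ρ)⁻¹))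
    {ε : ℝ} (hε : 0 < ε) : ∃ s : ℝ, 0 < s ∧ ∀ (n : ℕ) (A : Finset (List ℕ)),
      (∀ L ∈ A, L ∈ comps d k n ∧ ε * n ≤ |(L.map a).sum - v * n|) →
      (A.card : ℝ) ≤ 2 * (Real.exp (-(s * n)) * (ρ ^ n)⁻¹) := by
  obtain ⟨s, hs, h⟩ := card_le_exp_of_le_sum hdk hρ ha hv hε
  obtain ⟨t, ht, h'⟩ := card_le_exp_of_le_sum hdk hρ (a := fun i => -a i) (v := -v)
    (by simpa using ha) (by
      rw [neg_mul]
      refine hv.neg.congr_fun fun i => ?_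
      by_cases hi : i ∈ parts d k
      · simp [Set.indicator_of_mem hi]
      · simp [Set.indicator_of_notMem hi]) hε
  have hneg : ∀ L : List ℕ, (L.map fun i => -a i).sum = -(L.map a).sum := fun L => by
    induction L with
    | nil => simp
    | cons b L ih => simp only [List.map_cons, List.sum_cons, ih]; ring
  refine ⟨min s t, lt_min hs ht, fun n A hA => ?_⟩
  rw [← Finset.card_filter_add_card_filter_not (s := A)
    (fun L => ε * n ≤ (L.map a).sum - v * n), Nat.cast_add, two_mul]
  have hp : 0 < (ρ ^ n)⁻¹ := inv_pos.2 (pow_pos hρ.1 n)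
  gcongr ?_ + ?_
  · refine (h n _ fun L hL => ?_).trans ?_
    · obtain ⟨h1, h2⟩ := Finset.mem_filter.1 hL
      exact ⟨(hA L h1).1, h2⟩
    · gcongr
      exact min_le_left _ _
  · refine (h' n _ fun L hL => ?_).trans ?_
    · obtain ⟨h1, h2⟩ := Finset.mem_filter.1 hL
      obtain ⟨h3, h4⟩ := hA L h1
      refine ⟨h3, ?_⟩
      rw [hneg]
      rcases le_abs.1 h4 with h5 | h5
      · exact absurd h5 h2
      · linarith
    · gcongr
      exact min_le_right _ _

end upper

/-! ### Concentration of the number of blocks and of the count of one block -/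

lemma S_eq_card (d : ℕ) (k : ℕ∞) (n : ℕ) : S d k n = (comps_finite d k n).toFinset.card := by
  rw [S_eq_ncard, Set.ncard_eq_toFinset_card _ (comps_finite d k n)]

lemma SRuns_eq_card (d : ℕ) (k : ℕ∞) (j n W l : ℕ) : SRuns d k j n W l =
    ((comps_finite d k n).toFinset.filter fun L => L.length = W ∧ L.count (j + 1) = l).card := by
  rw [SRuns_eq_ncard, ← Set.ncard_coe_finset]
  congr 1
  ext L
  simp

lemma SRuns_le_S (d : ℕ) (k : ℕ∞) (j n W l : ℕ) : SRuns d k j n W l ≤ S d k n := by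
  rw [SRuns_eq_card, S_eq_card]
  exact Finset.card_filter_le _ _

lemma typicalCount_eq_card (d : ℕ) (k : ℕ∞) (j n : ℕ) (w v r : ℝ) : typicalCount d k j n w v r =
    ((comps_finite d k n).toFinset.filter fun L =>
      |(L.length : ℝ) - w * n| ≤ r ∧ |(L.count (j + 1) : ℝ) - v * n| ≤ r).card := by
  rw [typicalCount, Finset.card_eq_sum_card_fiberwise
    (f := fun L : List ℕ => (L.length, L.count (j + 1)))]
  · refine Finset.sum_congr rfl fun p hp => ?_
    rw [SRuns_eq_card, Finset.filter_filter]
    congr 1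
    refine Finset.filter_congr fun L _ => ?_
    have := (Finset.mem_filter.1 hp).2
    constructor
    · rintro ⟨h1, h2⟩
      rw [h1, h2]
      exact ⟨this, rfl⟩
    · rintro ⟨-, rfl⟩
      exact ⟨rfl, rfl⟩
  · intro L hL
    obtain ⟨h1, h2⟩ := Finset.mem_filter.1 (Finset.mem_coe.1 hL)
    have h3 := length_le_of_mem_comps ((Set.Finite.mem_toFinset _).1 h1)
    have h4 := List.count_le_length (a := j + 1) (l := L)
    simp only [Finset.coe_filter, Finset.mem_product, Finset.mem_range]
    exact ⟨⟨by omega, by omega⟩, h2⟩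

lemma typicalCount_le_S (d : ℕ) (k : ℕ∞) (j n : ℕ) (w v r : ℝ) :
    typicalCount d k j n w v r ≤ S d k n := by
  rw [typicalCount_eq_card, S_eq_card]
  exact Finset.card_filter_le _ _

section

variable {d : ℕ} {k : ℕ∞} {ρ : ℝ}

lemma S_le_inv_pow (hρ : IsPosRoot d k ρ) (n : ℕ) : (S d k n : ℝ) ≤ (ρ ^ n)⁻¹ := by
  rw [S_eq_card]
  exact card_le_inv_pow hρ fun L hL => (Set.Finite.mem_toFinset _).1 hL

/-- The deviation bound is used for `a = 1`, which measures length, and for the indicator of `j +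
1`, which measures its count. Two two-sided bounds give the factor 4. -/
lemma S_sub_typicalCount_le (hdk : (d : ℕ∞) < k) (hρ : IsPosRoot d k ρ) {j : ℕ}
    (hj : j + 1 ∈ parts d k) {ε : ℝ} (hε : 0 < ε) : ∃ s : ℝ, 0 < s ∧ ∀ n : ℕ,
    (S d k n : ℝ) - typicalCount d k j n (wStar d k ρ) (lamStar d k ρ j) (ε * n) ≤
      4 * (Real.exp (-(s * n)) * (ρ ^ n)⁻¹) := by
  have hw := hρ.wStar_pos hdk
  obtain ⟨s, hs, h⟩ := card_le_exp_of_le_abs_sum hdk hρ (a := fun _ => 1) (v := wStar d k ρ)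
    (by simp) (by rw [mul_inv_cancel₀ hw.ne']; simpa using hρ.hasSum) hε
  obtain ⟨t, ht, h'⟩ := card_le_exp_of_le_abs_sum hdk hρ
    (a := fun i => if i = j + 1 then 1 else 0) (v := lamStar d k ρ j)
    (fun i => by split_ifs <;> simp) (by
      rw [lamStar, mul_assoc, mul_inv_cancel₀ hw.ne', mul_one]
      refine (hasSum_ite_eq (j + 1) (ρ ^ (j + 1))).congr_fun fun i => ?_
      by_cases hi : i = j + 1
      · subst hi
        rw [Set.indicator_of_mem hj]
        simp
      · by_cases hp : i ∈ parts d k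
        · simp [Set.indicator_of_mem hp, hi]
        · simp [Set.indicator_of_notMem hp, hi]) hε
  have hlen : ∀ L : List ℕ, (L.map fun _ => (1 : ℝ)).sum = L.length := fun L => by simp
  have hcount : ∀ L : List ℕ, (L.map fun i => if i = j + 1 then (1 : ℝ) else 0).sum =
      L.count (j + 1) := fun L => by
    induction L with
    | nil => simp
    | cons b L ih =>
      rw [List.map_cons, List.sum_cons, ih, List.count_cons]
      by_cases hb : b = j + 1
      · simp [hb, add_comm]
      · simp [hb]
  refine ⟨min s t, lt_min hs ht, fun n => ?_⟩
  set C := (comps_finite d k n).toFinset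
  have hp : 0 < (ρ ^ n)⁻¹ := inv_pos.2 (pow_pos hρ.1 n)
  have h1 : ((C.filter fun L => ε * n ≤ |(L.length : ℝ) - wStar d k ρ * n|).card : ℝ) ≤
      2 * (Real.exp (-(min s t * n)) * (ρ ^ n)⁻¹) := by
    refine (h n _ fun L hL => ?_).trans ?_
    · obtain ⟨h1, h2⟩ := Finset.mem_filter.1 hL
      exact ⟨(Set.Finite.mem_toFinset _).1 h1, by rwa [hlen]⟩
    · gcongr
      exact min_le_left _ _
  have h2 : ((C.filter fun L => ε * n ≤ |(L.count (j + 1) : ℝ) - lamStar d k ρ j * n|).card : ℝ) ≤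
      2 * (Real.exp (-(min s t * n)) * (ρ ^ n)⁻¹) := by
    refine (h' n _ fun L hL => ?_).trans ?_
    · obtain ⟨h1, h2⟩ := Finset.mem_filter.1 hL
      exact ⟨(Set.Finite.mem_toFinset _).1 h1, by rwa [hcount]⟩
    · gcongr
      exact min_le_right _ _
  have h3 : S d k n ≤ typicalCount d k j n (wStar d k ρ) (lamStar d k ρ j) (ε * n) +
      ((C.filter fun L => ε * n ≤ |(L.length : ℝ) - wStar d k ρ * n|).card +
      (C.filter fun L => ε * n ≤ |(L.count (j + 1) : ℝ) - lamStar d k ρ j * n|).card) := by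
    rw [S_eq_card, typicalCount_eq_card]
    refine le_trans (Finset.card_le_card fun L hL => ?_) ((Finset.card_union_le _ _).trans
      (Nat.add_le_add_left (Finset.card_union_le _ _) _))
    simp only [Finset.mem_union, Finset.mem_filter]
    rcases le_or_gt |(L.length : ℝ) - wStar d k ρ * n| (ε * n) with h4 | h4
    · rcases le_or_gt |(L.count (j + 1) : ℝ) - lamStar d k ρ j * n| (ε * n) with h5 | h5
      · exact Or.inl ⟨hL, h4, h5⟩
      · exact Or.inr (Or.inr ⟨hL, h5.le⟩)
    · exact Or.inr (Or.inl ⟨hL, h4.le⟩)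
  have h4 : (S d k n : ℝ) ≤ _ := Nat.cast_le.2 h3
  push_cast at h4
  linarith

end

/-! ### Factorials and the entropy lower bound -/

lemma le_log_factorial (m : ℕ) : m * Real.log m - m ≤ Real.log m.factorial := by
  rcases Nat.eq_zero_or_pos m with rfl | hm
  · simp
  · have := Stirling.le_log_factorial_stirling hm.ne'
    have h1 : 0 ≤ Real.log m := Real.log_natCast_nonneg m
    have h2 : 0 ≤ Real.log (2 * Real.pi) := Real.log_nonneg (by linarith [Real.pi_gt_three])
    linarith

lemma log_factorial_le (m : ℕ) :
    Real.log m.factorial ≤ m * Real.log m - m + Real.log m + 1 := by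
  rcases Nat.eq_zero_or_pos m with rfl | hm
  · simp
  · induction m, hm using Nat.le_induction with
    | base => simp
    | succ m hm ih =>
      have hm0 : (0 : ℝ) < m := by exact_mod_cast hm
      rw [Nat.factorial_succ, Nat.cast_mul, Real.log_mul (by positivity) (by positivity)]
      have h := Real.add_one_le_exp (Real.log m - Real.log (m + 1 : ℕ))
      rw [Real.exp_sub, Real.exp_log hm0, Real.exp_log (by positivity), le_div_iff₀ (by positivity)]
        at h
      push_cast at h ⊢
      nlinarith

/-- Stirling with error `O(log n)`, normalised by `n` rather than `c n` so that the corrections are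
linear in `c` and cancel in a multinomial coefficient. -/
lemma tendsto_log_factorial_div {c : ℕ → ℕ} {γ : ℝ}
    (hc : Tendsto (fun n => (c n : ℝ) / n) atTop (𝓝 γ)) :
    Tendsto (fun n : ℕ => (Real.log (c n).factorial - c n * Real.log n + c n) / n) atTop
      (𝓝 (-Real.negMulLog γ)) := by
  have hmain : Tendsto (fun n => -Real.negMulLog ((c n : ℝ) / n)) atTop (𝓝 (-Real.negMulLog γ)) :=
    ((Real.continuous_negMulLog.tendsto γ).comp hc).neg
  have hlog : Tendsto (fun n : ℕ => Real.log n / n) atTop (𝓝 0) :=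
    (Real.isLittleO_log_id_atTop.tendsto_div_nhds_zero).comp tendsto_natCast_atTop_atTop
  -- `K` eventually bounds `c n / n`; being at least 1 it has `log K ≥ 0`, which also covers `c n =
  -- 0`.
  set K := max (γ + 1) 1
  have hK1 : 1 ≤ K := le_max_right _ _
  have herr : Tendsto (fun n : ℕ => Real.log n / n + (Real.log K + 1) * (1 / (n : ℝ))) atTop
      (𝓝 0) := by
    simpa using hlog.add (tendsto_one_div_atTop_nhds_zero_nat.const_mul (Real.log K + 1))
  have hup := hmain.add herr
  rw [add_zero] at hup
  have hid : ∀ n : ℕ, 0 < n → (c n : ℝ) * Real.log (c n) - c n * Real.log n =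
      n * (-Real.negMulLog ((c n : ℝ) / n)) := by
    intro n hn
    have hn' : (n : ℝ) ≠ 0 := by positivity
    rcases Nat.eq_zero_or_pos (c n) with h0 | h0
    · simp [h0]
    · rw [Real.negMulLog, Real.log_div (by positivity) hn']
      field_simp
  refine tendsto_of_tendsto_of_tendsto_of_le_of_le' hmain hup ?_ ?_
  · filter_upwards [eventually_gt_atTop 0] with n hn
    rw [le_div_iff₀ (by positivity)]
    linarith [hid n hn, le_log_factorial (c n)]
  · filter_upwards [eventually_gt_atTop 0, hc.eventually_lt_const (show γ < γ + 1 by linarith)]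
      with n hn hlt
    have hn' : (0 : ℝ) < n := by positivity
    rw [div_le_iff₀ hn', add_mul, add_mul, div_mul_cancel₀ _ hn'.ne', mul_assoc,
      div_mul_cancel₀ _ hn'.ne']
    have hlogc : Real.log (c n) ≤ Real.log n + Real.log K := by
      rcases Nat.eq_zero_or_pos (c n) with h0 | h0
      · simp only [h0, Nat.cast_zero, Real.log_zero]
        have := Real.log_natCast_nonneg n
        have := Real.log_nonneg hK1
        positivity
      · rw [← Real.log_mul hn'.ne' (by positivity)]
        refine Real.log_le_log (by positivity) ?_
        rw [div_lt_iff₀ hn'] at hlt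
        have : (γ + 1) * n ≤ K * n := by gcongr; exact le_max_left _ _
        linarith
    linarith [hid n hn, log_factorial_le (c n)]

/-- Words with given letter frequencies are counted, on the exponential scale, by entropy. -/
lemma eventually_exp_le_SRuns {d : ℕ} {k : ℕ∞} {F : Finset ℕ} (hF : ∀ i ∈ F, i ∈ parts d k)
    {j : ℕ} (hj : j + 1 ∈ F) {c : ℕ → ℕ → ℕ} {γ : ℕ → ℝ} {W l : ℕ → ℕ}
    (hc : ∀ i ∈ F, Tendsto (fun n => (c n i : ℝ) / n) atTop (𝓝 (γ i)))
    (hW : ∀ᶠ n in atTop, ∑ i ∈ F, c n i = W n)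
    (hn : ∀ᶠ n in atTop, ∑ i ∈ F, i * c n i = n)
    (hl : ∀ᶠ n in atTop, c n (j + 1) = l n) {η : ℝ}
    (hη : η < ∑ i ∈ F, Real.negMulLog (γ i) - Real.negMulLog (∑ i ∈ F, γ i)) :
    ∀ᶠ n : ℕ in atTop, Real.exp (η * n) ≤ SRuns d k j n (W n) (l n) := by
  have hsum : Tendsto (fun n => ((∑ i ∈ F, c n i : ℕ) : ℝ) / n) atTop (𝓝 (∑ i ∈ F, γ i)) := by
    simp only [Nat.cast_sum, Finset.sum_div]
    exact tendsto_finsetSum _ hc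
  -- In this difference the terms `c log n` and `c` cancel because the counts add up to `W n`.
  have hlim := (tendsto_log_factorial_div hsum).sub
    (tendsto_finsetSum F fun i hi => tendsto_log_factorial_div (hc i hi))
  rw [show -Real.negMulLog (∑ i ∈ F, γ i) - ∑ i ∈ F, -Real.negMulLog (γ i) =
    ∑ i ∈ F, Real.negMulLog (γ i) - Real.negMulLog (∑ i ∈ F, γ i) by
      rw [Finset.sum_neg_distrib]; ring] at hlim
  filter_upwards [hlim.eventually_const_lt hη, hW, hn, hl, eventually_gt_atTop 0]
    with n h1 h2 h3 h4 h5
  have hn' : (0 : ℝ) < n := by positivity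
  obtain ⟨A, hA, hcard⟩ := exists_finset_count_eq F (W n) (c n) h2
  have hsub : A.card ≤ SRuns d k j n (W n) (l n) := by
    rw [SRuns_eq_card]
    refine Finset.card_le_card fun L hL => ?_
    obtain ⟨hLF, hLc⟩ := hA L hL
    refine Finset.mem_filter.2 ⟨(Set.Finite.mem_toFinset _).2
      ⟨fun i hi => hF i (hLF i hi), ?_⟩, ?_, ?_⟩
    · rw [Finset.sum_list_count_of_subset L F fun i hi => hLF i (List.mem_toFinset.1 hi), ← h3]
      refine Finset.sum_congr rfl fun i hi => ?_
      rw [hLc i hi, smul_eq_mul, mul_comm]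
    · have := Multiset.sum_count_eq_card (s := F) (m := (L : Multiset ℕ)) (by simpa using hLF)
      rw [Multiset.coe_card] at this
      rw [← this, ← h2]
      exact Finset.sum_congr rfl fun i hi => by rw [Multiset.coe_count, hLc i hi]
    · rw [hLc _ hj, h4]
  refine le_trans ?_ (Nat.cast_le.2 hsub)
  have hA0 : A.card ≠ 0 := by
    intro h0
    rw [h0, zero_mul] at hcard
    exact absurd hcard (not_le.2 (Nat.factorial_pos _))
  have hA0' : (0 : ℝ) < A.card := by exact_mod_cast Nat.pos_of_ne_zero hA0
  have hlogc : Real.log (W n).factorial ≤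
      Real.log A.card + ∑ i ∈ F, Real.log (c n i).factorial := by
    rw [← Real.log_prod (fun i _ => by positivity), ← Real.log_mul hA0'.ne'
      (Finset.prod_ne_zero_iff.2 fun i _ => by positivity)]
    refine Real.log_le_log (by positivity) ?_
    exact_mod_cast hcard
  rw [← Real.le_log_iff_exp_le hA0']
  rw [h2, ← Finset.sum_div, ← sub_div, lt_div_iff₀ hn'] at h1
  rw [Finset.sum_add_distrib, Finset.sum_sub_distrib, ← Finset.sum_mul] at h1
  have h6 : ∑ i ∈ F, (c n i : ℝ) = W n := by exact_mod_cast h2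
  rw [h6] at h1
  linarith

/-! ### The ideal frequencies and their truncation -/

section

variable {d : ℕ} {k : ℕ∞} {ρ : ℝ}

lemma hasSum_frequency (hρ : IsPosRoot d k ρ) :
    HasSum ((parts d k).indicator fun i => wStar d k ρ * ρ ^ i) (wStar d k ρ) := by
  have h := hρ.hasSum.mul_left (wStar d k ρ)
  rw [mul_one] at h
  refine h.congr_fun fun i => ?_
  by_cases hi : i ∈ parts d k
  · simp only [Set.indicator_of_mem hi]
  · simp [Set.indicator_of_notMem hi]

lemma hasSum_mul_frequency (hdk : (d : ℕ∞) < k) (hρ : IsPosRoot d k ρ) :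
    HasSum ((parts d k).indicator fun i => (i : ℝ) * (wStar d k ρ * ρ ^ i)) 1 := by
  have h := (hρ.hasSum_mul hdk).mul_left (wStar d k ρ)
  rw [mul_inv_cancel₀ (hρ.wStar_pos hdk).ne'] at h
  refine h.congr_fun fun i => ?_
  by_cases hi : i ∈ parts d k
  · simp only [Set.indicator_of_mem hi]
    ring
  · simp [Set.indicator_of_notMem hi]

/-- `log (w ρ^i) = log w + i log ρ` is affine in `i`, so the entropy reduces to the two linear
constraints. -/
lemma hasSum_negMulLog (hdk : (d : ℕ∞) < k) (hρ : IsPosRoot d k ρ) :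
    HasSum ((parts d k).indicator fun i => Real.negMulLog (wStar d k ρ * ρ ^ i))
      (Real.negMulLog (wStar d k ρ) - Real.log ρ) := by
  have hw := hρ.wStar_pos hdk
  have h := (hρ.hasSum.mul_left (Real.negMulLog (wStar d k ρ))).add
    ((hρ.hasSum_mul hdk).mul_left (-(wStar d k ρ * Real.log ρ)))
  rw [mul_one, neg_mul, mul_right_comm, mul_inv_cancel₀ hw.ne', one_mul, ← sub_eq_add_neg] at h
  refine h.congr_fun fun i => ?_
  by_cases hi : i ∈ parts d k
  · simp only [Set.indicator_of_mem hi]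
    rw [Real.negMulLog, Real.negMulLog, Real.log_mul hw.ne' (pow_pos hρ.1 i).ne', Real.log_pow]
    ring
  · simp [Set.indicator_of_notMem hi]

open Classical in
/-- Frequencies on a finite set of parts that satisfy the two linear constraints exactly, differ
from the ideal ones only at `a` and `a + 1`, and have almost the ideal entropy. -/
lemma exists_finite_frequencies (hdk : (d : ℕ∞) < k) (hρ : IsPosRoot d k ρ) {a t : ℕ}
    (ha : a ∈ parts d k) (ha' : a + 1 ∈ parts d k) (ht : t ∈ parts d k) (hta : t ≠ a)
    (hta' : t ≠ a + 1) {η : ℝ} (hη : η < -Real.log ρ) :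
    ∃ (F : Finset ℕ) (γ : ℕ → ℝ), (∀ i ∈ F, i ∈ parts d k) ∧ a ∈ F ∧ a + 1 ∈ F ∧ t ∈ F ∧
      (∀ i ∈ F, 0 < γ i) ∧ ∑ i ∈ F, γ i = wStar d k ρ ∧ ∑ i ∈ F, i * γ i = 1 ∧
      γ t = ρ ^ t * wStar d k ρ ∧
      η < ∑ i ∈ F, Real.negMulLog (γ i) - Real.negMulLog (∑ i ∈ F, γ i) := by
  have hw := hρ.wStar_pos hdk
  set w := wStar d k ρ with hwdef
  set F : ℕ → Finset ℕ := fun K => (Finset.range K).filter (· ∈ parts d k) with hF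
  have hsumF : ∀ (f : ℕ → ℝ) (K : ℕ),
      ∑ i ∈ F K, f i = ∑ i ∈ Finset.range K, (parts d k).indicator f i := fun f K => by
    rw [hF, Finset.sum_filter]
    rfl
  have htend : ∀ (f : ℕ → ℝ) (x : ℝ), HasSum ((parts d k).indicator f) x →
      Tendsto (fun K => ∑ i ∈ F K, f i) atTop (𝓝 x) := fun f x h => by
    simp only [hsumF]
    exact h.tendsto_sum_nat
  set g : ℕ → ℝ := fun i => w * ρ ^ i with hg
  have hg0 : ∀ i, 0 < g i := fun i => mul_pos hw (pow_pos hρ.1 i)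
  have hT0 : Tendsto (fun K => w - ∑ i ∈ F K, g i) atTop (𝓝 0) := by
    have := htend g w (hasSum_frequency hρ)
    simpa using this.const_sub w
  have hT1 : Tendsto (fun K => 1 - ∑ i ∈ F K, i * g i) atTop (𝓝 0) := by
    have := htend (fun i => i * g i) 1 (hasSum_mul_frequency hdk hρ)
    simpa using this.const_sub 1
  -- `ε` and `δ` solve `ε + δ = ` lost mass and `a ε + (a+1) δ = ` lost first moment; both tend to 0
  -- as `K` grows.
  set δ : ℕ → ℝ := fun K => (1 - ∑ i ∈ F K, i * g i) - a * (w - ∑ i ∈ F K, g i) with hδ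
  set ε : ℕ → ℝ := fun K => (w - ∑ i ∈ F K, g i) - δ K with hε
  have hδ0 : Tendsto δ atTop (𝓝 0) := by simpa using hT1.sub (hT0.const_mul (a : ℝ))
  have hε0 : Tendsto ε atTop (𝓝 0) := by simpa using hT0.sub hδ0
  set γ : ℕ → ℕ → ℝ := fun K i =>
    g i + (if i = a then ε K else 0) + (if i = a + 1 then δ K else 0) with hγ
  have hsplit : ∀ (f : ℕ → ℝ → ℝ) (K : ℕ), a ∈ F K → a + 1 ∈ F K → ∑ i ∈ F K, f i (γ K i) =
      ∑ i ∈ F K, f i (g i) + (f a (g a + ε K) - f a (g a)) +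
        (f (a + 1) (g (a + 1) + δ K) - f (a + 1) (g (a + 1))) := by
    intro f K h1 h2
    have : ∀ i ∈ F K, f i (γ K i) = f i (g i) +
        (if i = a then (f a (g a + ε K) - f a (g a)) else 0) +
        (if i = a + 1 then (f (a + 1) (g (a + 1) + δ K) - f (a + 1) (g (a + 1))) else 0) := by
      intro i _
      by_cases hi : i = a
      · subst hi; simp [hγ]
      · by_cases hi' : i = a + 1
        · subst hi'; simp [hγ]
        · simp [hγ, hi, hi']
    rw [Finset.sum_congr rfl this, Finset.sum_add_distrib, Finset.sum_add_distrib,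
      Finset.sum_ite_eq' , Finset.sum_ite_eq', if_pos h1, if_pos h2]
  have hmem : ∀ i ∈ parts d k, ∀ᶠ K in atTop, i ∈ F K := fun i hi => by
    filter_upwards [eventually_gt_atTop i] with K hK
    exact Finset.mem_filter.2 ⟨Finset.mem_range.2 hK, hi⟩
  have hcont : ∀ (x : ℝ) (u : ℕ → ℝ), Tendsto u atTop (𝓝 0) →
      Tendsto (fun K => Real.negMulLog (x + u K) - Real.negMulLog x) atTop (𝓝 0) := by
    intro x u hu
    have h1 : Tendsto (fun K => x + u K) atTop (𝓝 x) := by simpa using hu.const_add x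
    simpa using ((Real.continuous_negMulLog.tendsto x).comp h1).sub_const (Real.negMulLog x)
  have hH : Tendsto (fun K => ∑ i ∈ F K, Real.negMulLog (g i) +
      (Real.negMulLog (g a + ε K) - Real.negMulLog (g a)) +
      (Real.negMulLog (g (a + 1) + δ K) - Real.negMulLog (g (a + 1))) - Real.negMulLog w) atTop
      (𝓝 (-Real.log ρ)) := by
    have := (((htend _ _ (hasSum_negMulLog hdk hρ)).add (hcont (g a) ε hε0)).add
      (hcont (g (a + 1)) δ hδ0)).sub_const (Real.negMulLog w)
    convert this using 2
    ring
  obtain ⟨K, h1, h2, h3, h4, h5, h6⟩ := ((hmem a ha).and <| (hmem _ ha').and <| (hmem t ht).and <|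
    (hH.eventually_const_lt hη).and <|
    (hε0.eventually_const_lt (neg_lt_zero.2 (hg0 a))).and
    (hδ0.eventually_const_lt (neg_lt_zero.2 (hg0 (a + 1))))).exists
  have hs0 : ∑ i ∈ F K, γ K i = w := by
    rw [hsplit (fun _ x => x) K h1 h2]
    simp only [hε]
    ring
  refine ⟨F K, γ K, fun i hi => (Finset.mem_filter.1 hi).2, h1, h2, h3, fun i _ => ?_, hs0, ?_,
    ?_, ?_⟩
  · simp only [hγ]
    by_cases hi : i = a
    · subst hi; simp; linarith
    · by_cases hi' : i = a + 1
      · subst hi'; simp; linarith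
      · simpa [hi, hi'] using hg0 i
  · rw [hsplit (fun i x => i * x) K h1 h2]
    simp only [hε, hδ]
    push_cast
    ring
  · simp only [hγ, if_neg hta, if_neg hta', hg]
    ring
  · rw [hs0, hsplit (fun _ x => Real.negMulLog x) K h1 h2]
    exact h4

end

/-! ### Integer frequencies up to bounded error -/

/-- `u n = γ n + O(1)`. -/
def Near (u : ℕ → ℝ) (γ : ℝ) : Prop :=
  (fun n : ℕ => u n - γ * n) =O[atTop] fun _ => (1 : ℝ)

lemma isRounding_iff_near {a : ℕ → ℕ} {γ : ℝ} : IsRounding a γ ↔ Near (fun n => (a n : ℝ)) γ := by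
  rw [Near, isBigO_one_nat_atTop_iff]
  rfl

namespace Near

variable {u v : ℕ → ℝ} {γ γ' : ℝ}

lemma add (hu : Near u γ) (hv : Near v γ') : Near (fun n => u n + v n) (γ + γ') :=
  (IsBigO.add hu hv).congr_left fun n => by ring

lemma const_mul (c : ℝ) (hu : Near u γ) : Near (fun n => c * u n) (c * γ) :=
  (IsBigO.const_mul_left hu c).congr_left fun n => by ring

lemma sub (hu : Near u γ) (hv : Near v γ') : Near (fun n => u n - v n) (γ - γ') :=
  (IsBigO.sub hu hv).congr_left fun n => by ring

lemma sum {ι : Type*} {F : Finset ι} {u : ι → ℕ → ℝ} {γ : ι → ℝ}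
    (h : ∀ i ∈ F, Near (u i) (γ i)) : Near (fun n => ∑ i ∈ F, u i n) (∑ i ∈ F, γ i) :=
  (IsBigO.sum h).congr_left fun n => by
    rw [Finset.sum_apply, Finset.sum_sub_distrib, Finset.sum_mul]

lemma congr' (hu : Near u γ) (h : ∀ᶠ n in atTop, u n = v n) : Near v γ :=
  IsBigO.congr' hu (h.mono fun n hn => by simp only [hn]) EventuallyEq.rfl

lemma natCast : Near (fun n => (n : ℝ)) 1 := by
  simp only [Near, one_mul, sub_self]
  exact isBigO_zero _ _

lemma floor (γ : ℝ) : Near (fun n : ℕ => (⌊γ * n⌋ : ℝ)) γ := by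
  refine IsBigO.of_bound 1 (Eventually.of_forall fun n => ?_)
  have h1 := Int.floor_le (γ * n)
  have h2 := Int.lt_floor_add_one (γ * n)
  rw [Real.norm_eq_abs, norm_one, abs_le]
  constructor <;> linarith

lemma tendsto (hu : Near u γ) : Tendsto (fun n => u n / n) atTop (𝓝 γ) := by
  have h : Tendsto (fun n : ℕ => (u n - γ * n) / n + γ) atTop (𝓝 (0 + γ)) := by
    refine Tendsto.add_const γ ?_
    refine IsLittleO.tendsto_div_nhds_zero (IsBigO.trans_isLittleO hu ?_)
    exact isLittleO_const_left.2 (Or.inr (tendsto_norm_atTop_atTop.comp tendsto_natCast_atTop_atTop))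
  rw [zero_add] at h
  refine h.congr' ?_
  filter_upwards [eventually_gt_atTop 0] with n hn
  have : (n : ℝ) ≠ 0 := by positivity
  field_simp
  ring

lemma eventually_pos (hu : Near u γ) (hγ : 0 < γ) : ∀ᶠ n in atTop, 0 < u n := by
  filter_upwards [hu.tendsto.eventually_const_lt hγ, eventually_gt_atTop 0] with n h1 h2
  have : (0 : ℝ) < n := by positivity
  exact (div_pos_iff_of_pos_right this).1 h1

end Near

/-- Integer frequencies near given ones can be adjusted at two consecutive parts so that both
linear constraints hold exactly. -/
lemma exists_int_frequencies {F : Finset ℕ} {a : ℕ} (ha : a ∈ F) (ha' : a + 1 ∈ F) {γ : ℕ → ℝ}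
    (hγ : ∑ i ∈ F, i * γ i = 1) {W : ℕ → ℤ} (hW : Near (fun n => (W n : ℝ)) (∑ i ∈ F, γ i))
    {e : ℕ → ℕ → ℤ} (he : ∀ i ∈ F, i ≠ a → i ≠ a + 1 → Near (fun n => (e n i : ℝ)) (γ i)) :
    ∃ c : ℕ → ℕ → ℤ, (∀ i ∈ F, Near (fun n => (c n i : ℝ)) (γ i)) ∧
      (∀ n, ∑ i ∈ F, c n i = W n) ∧ (∀ n, ∑ i ∈ F, (i : ℤ) * c n i = n) ∧
      ∀ n i, i ≠ a → i ≠ a + 1 → c n i = e n i := by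
  set G := (F.erase a).erase (a + 1) with hG
  have hsplit : ∀ {R : Type} [AddCommMonoid R] (f : ℕ → R),
      ∑ i ∈ F, f i = f a + (f (a + 1) + ∑ i ∈ G, f i) := fun f => by
    rw [← Finset.add_sum_erase F f ha,
      ← Finset.add_sum_erase (F.erase a) f (Finset.mem_erase.2 ⟨by omega, ha'⟩)]
  have hGmem : ∀ i ∈ G, i ∈ F ∧ i ≠ a ∧ i ≠ a + 1 := fun i hi => by
    simp only [hG, Finset.mem_erase] at hi
    exact ⟨hi.2.2, hi.2.1, hi.1⟩
  -- The system for the counts at `a` and `a + 1` has determinant `(a+1) - a = 1`, so its solution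
  -- is integral.
  set v : ℕ → ℤ := fun n => n - ∑ i ∈ G, (i : ℤ) * e n i - a * (W n - ∑ i ∈ G, e n i) with hv
  set u : ℕ → ℤ := fun n => W n - ∑ i ∈ G, e n i - v n with hu
  set c : ℕ → ℕ → ℤ := fun n i => if i = a then u n else if i = a + 1 then v n else e n i with hc
  have hca : ∀ n, c n a = u n := fun n => by simp [hc]
  have hca' : ∀ n, c n (a + 1) = v n := fun n => by simp [hc]
  have hco : ∀ n i, i ≠ a → i ≠ a + 1 → c n i = e n i := fun n i h1 h2 => by simp [hc, h1, h2]
  have hcG : ∀ n, ∀ i ∈ G, c n i = e n i := fun n i hi => hco n i (hGmem i hi).2.1 (hGmem i hi).2.2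
  have heG : ∀ i ∈ G, Near (fun n => (e n i : ℝ)) (γ i) := fun i hi =>
    he i (hGmem i hi).1 (hGmem i hi).2.1 (hGmem i hi).2.2
  rw [hsplit] at hγ hW
  have hvN : Near (fun n => (v n : ℝ)) (γ (a + 1)) := by
    have := (Near.natCast.sub (Near.sum fun i hi => (heG i hi).const_mul (i : ℝ))).sub
      ((hW.sub (Near.sum heG)).const_mul (a : ℝ))
    convert this using 1
    · ext n
      simp [hv]
    · rw [← hγ]
      push_cast
      ring
  have huN : Near (fun n => (u n : ℝ)) (γ a) := by
    have := (hW.sub (Near.sum heG)).sub hvN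
    convert this using 1
    · ext n
      simp [hu]
    · ring
  refine ⟨c, fun i hi => ?_, fun n => ?_, fun n => ?_, hco⟩
  · by_cases h1 : i = a
    · subst h1; simpa only [hca] using huN
    · by_cases h2 : i = a + 1
      · subst h2; simpa only [hca'] using hvN
      · simpa only [hco _ i h1 h2] using he i hi h1 h2
  · rw [hsplit, hca, hca', Finset.sum_congr rfl (hcG n)]
    simp only [hu]
    ring
  · rw [hsplit, hca, hca', Finset.sum_congr rfl fun i hi => by rw [hcG n i hi]]
    simp only [hu, hv]
    push_cast
    ring

/-! ### Lower bounds for prescribed `W` and `l` -/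

/-- Integer frequencies that satisfy the constraints and are near positive multiples of `n`
realize the entropy lower bound. -/
lemma eventually_exp_le_SRuns_of_int {d : ℕ} {k : ℕ∞} {F : Finset ℕ}
    (hF : ∀ i ∈ F, i ∈ parts d k) {j : ℕ} (hj : j + 1 ∈ F) {c : ℕ → ℕ → ℤ} {γ : ℕ → ℝ}
    {W l : ℕ → ℕ} (hγ : ∀ i ∈ F, 0 < γ i) (hc : ∀ i ∈ F, Near (fun n => (c n i : ℝ)) (γ i))
    (hW : ∀ᶠ n in atTop, ∑ i ∈ F, c n i = W n)
    (hn : ∀ᶠ n : ℕ in atTop, ∑ i ∈ F, (i : ℤ) * c n i = n)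
    (hl : ∀ᶠ n in atTop, c n (j + 1) = l n) {η : ℝ}
    (hη : η < ∑ i ∈ F, Real.negMulLog (γ i) - Real.negMulLog (∑ i ∈ F, γ i)) :
    ∀ᶠ n : ℕ in atTop, Real.exp (η * n) ≤ SRuns d k j n (W n) (l n) := by
  -- Positive frequencies make the integer counts eventually positive, so `toNat` loses nothing.
  have hpos : ∀ᶠ n in atTop, ∀ i ∈ F, ((c n i).toNat : ℤ) = c n i := by
    rw [Finset.eventually_all]
    intro i hi
    filter_upwards [(hc i hi).eventually_pos (hγ i hi)] with n h
    have : (0 : ℤ) < c n i := by exact_mod_cast h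
    omega
  refine eventually_exp_le_SRuns hF hj (c := fun n i => (c n i).toNat) (γ := γ) (fun i hi => ?_)
    ?_ ?_ ?_ hη
  · refine ((hc i hi).congr' ?_).tendsto
    filter_upwards [hpos] with n h
    have := h i hi
    exact_mod_cast this.symm
  · filter_upwards [hpos, hW] with n h1 h2
    zify
    rw [Finset.sum_congr rfl h1, h2]
  · filter_upwards [hpos, hn] with n h1 h2
    zify
    rw [Finset.sum_congr rfl fun i hi => by rw [h1 i hi], h2]
  · filter_upwards [hpos, hl] with n h1 h2
    zify
    rw [h1 _ hj, h2]

section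

variable {d : ℕ} {k : ℕ∞} {ρ : ℝ}

/-- The corrections happen only at `a` and `a + 1`, so the count of `j + 1` can be set to `l n`
exactly. -/
lemma eventually_exp_le_SRuns_of_consecutive (hdk : (d : ℕ∞) < k) (hρ : IsPosRoot d k ρ) {a j : ℕ}
    (ha : a ∈ parts d k) (ha' : a + 1 ∈ parts d k) (hj : j + 1 ∈ parts d k) (hja : j + 1 ≠ a)
    (hja' : j + 1 ≠ a + 1) {W l : ℕ → ℕ} (hW : IsRounding W (wStar d k ρ))
    (hl : IsRounding l (lamStar d k ρ j)) {η : ℝ} (hη : η < -Real.log ρ) :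
    ∀ᶠ n : ℕ in atTop, Real.exp (η * n) ≤ SRuns d k j n (W n) (l n) := by
  obtain ⟨F, γ, hF, haF, haF', hjF, hγ0, hγw, hγ1, hγj, hent⟩ :=
    exists_finite_frequencies hdk hρ ha ha' hj hja hja' hη
  rw [isRounding_iff_near] at hW hl
  obtain ⟨c, hc, h1, h2, h3⟩ := exists_int_frequencies haF haF' hγ1 (W := fun n => W n)
    (by rw [hγw]; simpa using hW)
    (e := fun n i => if i = j + 1 then l n else ⌊γ i * n⌋) (fun i _ _ _ => by
      by_cases hi : i = j + 1
      · subst hi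
        simpa [hγj, lamStar] using hl
      · simpa [hi] using Near.floor (γ i))
  exact eventually_exp_le_SRuns_of_int hF hjF hγ0 hc (Eventually.of_forall h1)
    (Eventually.of_forall h2) (Eventually.of_forall fun n => by simp [h3 n _ hja hja']) hent

lemma sum_eq_of_hasSum_indicator {F : Finset ℕ} (hF : parts d k = ↑F) {f : ℕ → ℝ} {x : ℝ}
    (h : HasSum ((parts d k).indicator f) x) : ∑ i ∈ F, f i = x := by
  rw [hF, ← hasSum_subtype_iff_indicator] at h
  exact (Finset.hasSum F f).unique h

/-- The corrections are made at `d + 1` and `d + 2`, possibly at `j + 1` itself; this is harmless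
since `l` is read off from the result. -/
lemma exists_rounding_of_finite (hdk : (d : ℕ∞) < k) (hρ : IsPosRoot d k ρ) {F : Finset ℕ}
    (hF : parts d k = ↑F) {j : ℕ} (hj : j + 1 ∈ parts d k) :
    ∃ W l : ℕ → ℕ, IsRounding W (wStar d k ρ) ∧ IsRounding l (lamStar d k ρ j) ∧
      ∀ η < -Real.log ρ, ∀ᶠ n : ℕ in atTop, Real.exp (η * n) ≤ SRuns d k j n (W n) (l n) := by
  have hw := hρ.wStar_pos hdk
  have hmem : ∀ i, i ∈ F ↔ i ∈ parts d k := fun i => by rw [hF]; simp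
  set γ : ℕ → ℝ := fun i => wStar d k ρ * ρ ^ i with hγ
  have hγ0 : ∀ i, 0 < γ i := fun i => mul_pos hw (pow_pos hρ.1 i)
  have hs0 : ∑ i ∈ F, γ i = wStar d k ρ := sum_eq_of_hasSum_indicator hF (hasSum_frequency hρ)
  have hs1 : ∑ i ∈ F, i * γ i = 1 := sum_eq_of_hasSum_indicator hF (hasSum_mul_frequency hdk hρ)
  have hs2 := sum_eq_of_hasSum_indicator hF (hasSum_negMulLog hdk hρ)
  obtain ⟨c, hc, h1, h2, -⟩ := exists_int_frequencies ((hmem _).2 (add_one_mem_parts hdk))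
    ((hmem _).2 (add_two_mem_parts hdk)) hs1 (W := fun n => ⌊wStar d k ρ * n⌋)
    (by rw [hs0]; exact Near.floor _)
    (e := fun n i => ⌊γ i * n⌋) (fun i _ _ _ => Near.floor (γ i))
  have hto : ∀ {u : ℕ → ℤ} {x : ℝ}, Near (fun n => (u n : ℝ)) x → 0 < x →
      ∀ᶠ n in atTop, ((u n).toNat : ℤ) = u n := fun hu hx => by
    filter_upwards [hu.eventually_pos hx] with n h
    have := Int.cast_pos.1 h
    omega
  have hto' : ∀ {u : ℕ → ℤ} {x : ℝ}, Near (fun n => (u n : ℝ)) x → 0 < x →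
      IsRounding (fun n => (u n).toNat) x := fun hu hx => by
    refine isRounding_iff_near.2 (hu.congr' ?_)
    filter_upwards [hto hu hx] with n h
    exact_mod_cast h.symm
  have hjF := (hmem _).2 hj
  have hl := hc _ hjF
  refine ⟨fun n => ⌊wStar d k ρ * n⌋.toNat, fun n => (c n (j + 1)).toNat,
    hto' (Near.floor _) hw, ?_, fun η hη => ?_⟩
  · rw [lamStar, mul_comm]
    exact hto' hl (hγ0 _)
  · refine eventually_exp_le_SRuns_of_int (fun i hi => (hmem i).1 hi) hjF (fun i _ => hγ0 i) hc
      ?_ (Eventually.of_forall h2) ?_ (hη.trans_eq ?_)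
    · filter_upwards [hto (Near.floor _) hw] with n h
      rw [h1, h]
    · filter_upwards [hto hl (hγ0 _)] with n h
      rw [h]
    · rw [hs0, hs2]
      ring

/-- If the letter counts of the counted strings are forced up to `O(1)`, then nonemptiness is
enough for the entropy lower bound. -/
lemma eventually_exp_le_SRuns_of_forced (hdk : (d : ℕ∞) < k) (hρ : IsPosRoot d k ρ) {F : Finset ℕ}
    (hF : parts d k = ↑F) {j : ℕ} (hj : j + 1 ∈ parts d k) {W l : ℕ → ℕ}
    (hne : ∀ᶠ n in atTop, SRuns d k j n (W n) (l n) ≠ 0)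
    (hforced : ∀ c : ℕ → ℕ → ℕ, (∀ᶠ n in atTop, ∑ i ∈ F, c n i = W n) →
      (∀ᶠ n in atTop, ∑ i ∈ F, i * c n i = n) → (∀ᶠ n in atTop, c n (j + 1) = l n) →
      ∀ i ∈ F, Near (fun n => (c n i : ℝ)) (wStar d k ρ * ρ ^ i))
    {η : ℝ} (hη : η < -Real.log ρ) :
    ∀ᶠ n : ℕ in atTop, Real.exp (η * n) ≤ SRuns d k j n (W n) (l n) := by
  have hmem : ∀ i, i ∈ F ↔ i ∈ parts d k := fun i => by rw [hF]; simp
  have hex : ∀ n, ∃ L : List ℕ, SRuns d k j n (W n) (l n) ≠ 0 →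
      L ∈ comps d k n ∧ L.length = W n ∧ L.count (j + 1) = l n := fun n => by
    by_cases h : SRuns d k j n (W n) (l n) = 0
    · exact ⟨[], fun h' => absurd h h'⟩
    · have h' := h
      rw [SRuns_eq_card, ← ne_eq, Finset.card_ne_zero] at h'
      obtain ⟨L, hL⟩ := h'
      obtain ⟨h1, h2⟩ := Finset.mem_filter.1 hL
      exact ⟨L, fun _ => ⟨(Set.Finite.mem_toFinset _).1 h1, h2⟩⟩
  choose L hL using hex
  have h1 : ∀ᶠ n in atTop, ∑ i ∈ F, (L n).count i = W n := by
    filter_upwards [hne] with n hn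
    obtain ⟨h1, h2, -⟩ := hL n hn
    have := Multiset.sum_count_eq_card (s := F) (m := (L n : Multiset ℕ))
      (by simpa [hmem] using h1.1)
    simpa [h2] using this
  have h2 : ∀ᶠ n in atTop, ∑ i ∈ F, i * (L n).count i = n := by
    filter_upwards [hne] with n hn
    obtain ⟨h1, -, -⟩ := hL n hn
    have := Finset.sum_list_count_of_subset (L n) F
      fun i hi => (hmem i).2 (h1.1 i (List.mem_toFinset.1 hi))
    rw [h1.2] at this
    simpa [mul_comm] using this.symm
  have h3 : ∀ᶠ n in atTop, (L n).count (j + 1) = l n := hne.mono fun n hn => (hL n hn).2.2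
  have hs0 := sum_eq_of_hasSum_indicator hF (hasSum_frequency hρ)
  have hs2 := sum_eq_of_hasSum_indicator hF (hasSum_negMulLog hdk hρ)
  refine eventually_exp_le_SRuns (fun i hi => (hmem i).1 hi) ((hmem _).2 hj)
    (c := fun n i => (L n).count i) (fun i hi => (hforced _ h1 h2 h3 i hi).tendsto) h1 h2 h3
    (hη.trans_eq ?_)
  rw [hs0, hs2]
  ring

/-- Either two consecutive parts avoid `j + 1`, or there are so few parts that the constraints
determine all counts up to `O(1)`. -/
lemma eventually_exp_le_SRuns_of_ne_zero (hdk : (d : ℕ∞) < k) (hρ : IsPosRoot d k ρ) {j : ℕ}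
    (hj : j + 1 ∈ parts d k) {W l : ℕ → ℕ} (hW : IsRounding W (wStar d k ρ))
    (hl : IsRounding l (lamStar d k ρ j)) (hne : ∀ᶠ n in atTop, SRuns d k j n (W n) (l n) ≠ 0)
    {η : ℝ} (hη : η < -Real.log ρ) :
    ∀ᶠ n : ℕ in atTop, Real.exp (η * n) ≤ SRuns d k j n (W n) (l n) := by
  by_cases hcons : ∃ a, a ∈ parts d k ∧ a + 1 ∈ parts d k ∧ j + 1 ≠ a ∧ j + 1 ≠ a + 1
  · obtain ⟨a, h1, h2, h3, h4⟩ := hcons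
    exact eventually_exp_le_SRuns_of_consecutive hdk hρ h1 h2 hj h3 h4 hW hl hη
  rw [isRounding_iff_near] at hW hl
  rw [lamStar, mul_comm] at hl
  induction k using ENat.recTopCoe with
  | top =>
    refine absurd ⟨j + 2, ?_, ?_, by omega, by omega⟩ hcons <;>
    · have := hj.1
      exact ⟨by omega, by simp⟩
  | coe m =>
    have hF := parts_natCast d m
    have hmem : ∀ i, i ∈ parts d m ↔ d + 1 ≤ i ∧ i ≤ m + 1 := fun i => by rw [hF]; simp
    simp only [hmem] at hcons hj
    push Not at hcons
    have hdm : d < m := by exact_mod_cast hdk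
    have hs0 := sum_eq_of_hasSum_indicator hF (hasSum_frequency hρ)
    have hs1 := sum_eq_of_hasSum_indicator hF (hasSum_mul_frequency hdk hρ)
    refine eventually_exp_le_SRuns_of_forced hdk hρ hF ((hmem _).2 hj) hne
      (fun c h1 h2 h3 => ?_) hη
    have hcl : Near (fun n => (c n (j + 1) : ℝ)) (wStar d m ρ * ρ ^ (j + 1)) :=
      hl.congr' (h3.mono fun n h => by rw [h])
    have hcases : (m = d + 1 ∧ (j = d ∨ j = d + 1)) ∨ (m = d + 2 ∧ j = d + 1) := by
      by_contra hcon
      have ha := hcons (d + 1)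
      have hb := hcons (d + 2)
      have hc := hcons (d + 3)
      omega
    generalize wStar d m ρ = w at hW hs0 hs1 hcl ⊢
    rcases hcases with ⟨rfl, hjd⟩ | ⟨rfl, rfl⟩
    · have hI : ∀ f : ℕ → ℝ, ∑ i ∈ Finset.Icc (d + 1) (d + 1 + 1), f i =
          f (d + 1) + f (d + 2) := fun f => by
        rw [Finset.sum_Icc_succ_top (by omega), Finset.Icc_self, Finset.sum_singleton]
      rw [hI] at hs0
      have hsum : Near (fun n => (c n (d + 1) : ℝ) + c n (d + 2)) _ :=
        hW.congr' (h1.mono fun n h => by rw [← hI (fun i => (c n i : ℝ))]; exact_mod_cast h.symm)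
      intro i hi
      have hi' := Finset.mem_Icc.1 hi
      have hi2 : i = j + 1 ∨ (i = d + 1 ∧ j = d + 1) ∨ (i = d + 2 ∧ j = d) := by omega
      rcases hi2 with rfl | ⟨rfl, rfl⟩ | ⟨rfl, rfl⟩
      · exact hcl
      · convert hsum.sub hcl using 1
        · ext n; ring
        · linear_combination hs0
      · convert hsum.sub hcl using 1
        · ext n; ring
        · linear_combination hs0
    · have hI : ∀ f : ℕ → ℝ, ∑ i ∈ Finset.Icc (d + 1) (d + 2 + 1), f i =
          f (d + 1) + f (d + 2) + f (d + 3) := fun f => by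
        rw [Finset.sum_Icc_succ_top (by omega), Finset.sum_Icc_succ_top (by omega),
          Finset.Icc_self, Finset.sum_singleton]
      rw [hI] at hs0 hs1
      push_cast at hs1
      have hsum : Near (fun n => (c n (d + 1) : ℝ) + c n (d + 2) + c n (d + 3)) _ :=
        hW.congr' (h1.mono fun n h => by rw [← hI (fun i => (c n i : ℝ))]; exact_mod_cast h.symm)
      have hsum' : Near (fun n => ((d + 1 : ℕ) : ℝ) * c n (d + 1) + (d + 2 : ℕ) * c n (d + 2) +
          (d + 3 : ℕ) * c n (d + 3)) 1 :=
        Near.natCast.congr' (h2.mono fun n h => by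
          rw [← hI (fun i => (i : ℝ) * c n i)]; exact_mod_cast h.symm)
      -- This combination is `c (d+3) - c (d+1)`; together with `c (d+1) + c (d+3)` from `hsum` and
      -- `hcl` it determines both counts.
      have hdiff := hsum'.sub (hsum.const_mul (d + 2 : ℝ))
      intro i hi
      have hi' := Finset.mem_Icc.1 hi
      have hi2 : i = d + 1 + 1 ∨ i = d + 1 ∨ i = d + 3 := by omega
      rcases hi2 with rfl | rfl | rfl
      · exact hcl
      · convert ((hsum.sub hcl).sub hdiff).const_mul (1 / 2) using 1
        · ext n; push_cast; ring
        · linear_combination ((d : ℝ) + 3) / 2 * hs0 - 1 / 2 * hs1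
      · convert ((hsum.sub hcl).add hdiff).const_mul (1 / 2) using 1
        · ext n; push_cast; ring
        · linear_combination -((d : ℝ) + 1) / 2 * hs0 + 1 / 2 * hs1

end

/-! ### From exponential bounds to the asymptotic statements -/

lemma exists_diagonal {A : ℕ → ℕ → Prop} (hA : ∀ m, ∀ᶠ n in atTop, A m n) :
    ∃ g : ℕ → ℕ, Tendsto g atTop atTop ∧ ∀ᶠ n in atTop, A (g n) n := by
  choose N hN using fun m => eventually_atTop.1 (hA m)
  refine ⟨fun n => Nat.findGreatest (fun m => N m ≤ n) n, ?_, ?_⟩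
  · refine tendsto_atTop.2 fun b => ?_
    filter_upwards [eventually_ge_atTop b, eventually_ge_atTop (N b)] with n h1 h2
    exact Nat.le_findGreatest h1 h2
  · filter_upwards [eventually_ge_atTop (N 0)] with n hn
    exact hN _ _ (Nat.findGreatest_spec (P := fun m => N m ≤ n) (Nat.zero_le n) hn)

lemma tendsto_log_div_of_exp_bounds {u : ℕ → ℝ} {ρ : ℝ}
    (hlow : ∀ η < -Real.log ρ, ∀ᶠ n : ℕ in atTop, Real.exp (η * n) ≤ u n)
    (hup : ∀ n, u n ≤ (ρ ^ n)⁻¹) :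
    Tendsto (fun n : ℕ => Real.log (u n) / n) atTop (𝓝 (-Real.log ρ)) := by
  rw [tendsto_order]
  refine ⟨fun x hx => ?_, fun x hx => ?_⟩
  · obtain ⟨y, hxy, hy⟩ := exists_between hx
    filter_upwards [hlow y hy, eventually_gt_atTop 0] with n h1 h2
    have hn : (0 : ℝ) < n := by exact_mod_cast h2
    have h3 := (Real.le_log_iff_exp_le ((Real.exp_pos _).trans_le h1)).2 h1
    exact hxy.trans_le ((le_div_iff₀ hn).2 h3)
  -- The lower bound serves only to make `u n` positive, so that `log` is monotone there.
  · filter_upwards [hlow (-Real.log ρ - 1) (by linarith), eventually_gt_atTop 0] with n h1 h2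
    have hn : (0 : ℝ) < n := by exact_mod_cast h2
    have h3 := Real.log_le_log ((Real.exp_pos _).trans_le h1) (hup n)
    rw [Real.log_inv, Real.log_pow] at h3
    refine lt_of_le_of_lt ((div_le_iff₀ hn).2 ?_) hx
    linarith

/-- `n^(log₂ n) = exp ((log n)² / log 2)` is subexponential. -/
lemma eventually_rpow_logb_le_exp {s : ℝ} (hs : 0 < s) :
    ∀ᶠ n : ℕ in atTop, 4 * (n : ℝ) ^ Real.logb 2 n ≤ Real.exp (s * n) := by
  have h1 : Tendsto (fun n : ℕ => Real.log n ^ 2 / n) atTop (𝓝 0) :=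
    (Real.isLittleO_pow_log_id_atTop.tendsto_div_nhds_zero).comp tendsto_natCast_atTop_atTop
  have h2 := (h1.mul_const (Real.log 2)⁻¹).add
    (tendsto_one_div_atTop_nhds_zero_nat.const_mul (Real.log 4))
  rw [zero_mul, mul_zero, add_zero] at h2
  filter_upwards [h2.eventually_lt_const hs, eventually_gt_atTop 0] with n h3 h4
  have hn : (0 : ℝ) < n := by exact_mod_cast h4
  rw [Real.rpow_def_of_pos hn, ← Real.exp_log (show (0 : ℝ) < 4 by norm_num), ← Real.exp_add,
    Real.exp_le_exp, Real.logb]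
  have h5 := mul_le_mul_of_nonneg_right h3.le hn.le
  refine le_trans (le_of_eq ?_) h5
  field_simp
  ring

section

variable {d : ℕ} {k : ℕ∞} {ρ : ℝ}

lemma simExp_of_exp_le (hdk : (d : ℕ∞) < k) (hρ : IsPosRoot d k ρ) {j : ℕ} {W l : ℕ → ℕ}
    (h : ∀ η < -Real.log ρ, ∀ᶠ n : ℕ in atTop, Real.exp (η * n) ≤ SRuns d k j n (W n) (l n)) :
    SimExp (fun n => (S d k n : ℝ)) (fun n => (SRuns d k j n (W n) (l n) : ℝ)) := by
  have hle : ∀ n, (SRuns d k j n (W n) (l n) : ℝ) ≤ S d k n := fun n =>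
    Nat.cast_le.2 (SRuns_le_S d k j n _ _)
  have h1 := tendsto_log_div_of_exp_bounds h fun n => (hle n).trans (S_le_inv_pow hρ n)
  have h2 := tendsto_log_div_of_exp_bounds
    (fun η hη => (h η hη).mono fun n hn => hn.trans (hle n)) (S_le_inv_pow hρ)
  have hH : -Real.log ρ ≠ 0 := by
    have := Real.log_neg hρ.1 (hρ.lt_one hdk)
    linarith
  have h3 := h2.div h1 hH
  rw [div_self hH] at h3
  refine h3.congr' ?_
  filter_upwards [eventually_gt_atTop 0] with n hn
  have hn' : (n : ℝ) ≠ 0 := by positivity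
  have h4 : Real.log 2 ≠ 0 := (Real.log_pos (by norm_num)).ne'
  simp only [Pi.div_apply, Real.logb]
  rw [div_div_div_cancel_right₀ hn', div_div_div_cancel_right₀ h4]

lemma exists_rounding (hdk : (d : ℕ∞) < k) (hρ : IsPosRoot d k ρ) {j : ℕ}
    (hj : j + 1 ∈ parts d k) :
    ∃ W l : ℕ → ℕ, IsRounding W (wStar d k ρ) ∧ IsRounding l (lamStar d k ρ j) ∧
      ∀ η < -Real.log ρ, ∀ᶠ n : ℕ in atTop, Real.exp (η * n) ≤ SRuns d k j n (W n) (l n) := by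
  induction k using ENat.recTopCoe with
  | coe m => exact exists_rounding_of_finite hdk hρ (parts_natCast d m) hj
  | top =>
    have hr : ∀ {x : ℝ}, 0 ≤ x → IsRounding (fun n : ℕ => ⌊x * n⌋₊) x := fun {x} hx => by
      refine isRounding_iff_near.2 ((Near.floor x).congr' (Eventually.of_forall fun n => ?_))
      exact (natCast_floor_eq_intCast_floor (by positivity)).symm
    have hw := hρ.wStar_pos hdk
    have h1 := hr hw.le
    have h2 := hr (mul_pos (pow_pos hρ.1 (j + 1)) hw).le
    have hd := hj.1
    exact ⟨_, _, h1, h2, fun η hη => eventually_exp_le_SRuns_of_consecutive hdk hρ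
      (a := j + 2) ⟨by omega, by simp⟩ ⟨by omega, by simp⟩ hj (by omega) (by omega) h1 h2 hη⟩

/-- The atypical strings number at most `4 exp (-s n) ρ^(-n)` and `S ≥ exp (-s n / 2) ρ^(-n)`
eventually; the remaining `exp (-s n / 2)` beats `4 n^(log₂ n)`. -/
lemma eventually_S_sub_typicalCount_le (hdk : (d : ℕ∞) < k) (hρ : IsPosRoot d k ρ) {j : ℕ}
    (hj : j + 1 ∈ parts d k) {ε : ℝ} (hε : 0 < ε) : ∀ᶠ n : ℕ in atTop,
    (S d k n : ℝ) - typicalCount d k j n (wStar d k ρ) (lamStar d k ρ j) (ε * n) ≤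
      S d k n / (n : ℝ) ^ Real.logb 2 n := by
  obtain ⟨s, hs, h⟩ := S_sub_typicalCount_le hdk hρ hj hε
  obtain ⟨W, l, -, -, hlow⟩ := exists_rounding hdk hρ hj
  filter_upwards [hlow (-Real.log ρ - s / 2) (by linarith),
    eventually_rpow_logb_le_exp (half_pos hs), eventually_gt_atTop 0] with n h1 h2 h3
  have hn : (0 : ℝ) < n := by exact_mod_cast h3
  refine (h n).trans ?_
  have hS : Real.exp ((-Real.log ρ - s / 2) * n) ≤ S d k n :=
    h1.trans (Nat.cast_le.2 (SRuns_le_S d k j n _ _))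
  rw [le_div_iff₀ (Real.rpow_pos_of_pos hn _)]
  refine le_trans ?_ hS
  have hρn : (ρ ^ n)⁻¹ = Real.exp (-Real.log ρ * n) := by
    rw [neg_mul, Real.exp_neg, mul_comm, Real.exp_nat_mul, Real.exp_log hρ.1]
  calc 4 * (Real.exp (-(s * n)) * (ρ ^ n)⁻¹) * (n : ℝ) ^ Real.logb 2 n
      = Real.exp (-(s * n)) * (ρ ^ n)⁻¹ * (4 * (n : ℝ) ^ Real.logb 2 n) := by ring
    _ ≤ Real.exp (-(s * n)) * (ρ ^ n)⁻¹ * Real.exp (s / 2 * n) := by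
        have := pow_pos hρ.1 n
        gcongr
    _ = Real.exp ((-Real.log ρ - s / 2) * n) := by
        rw [hρn, ← Real.exp_add, ← Real.exp_add]
        ring_nf

end

end RLL

theorem lemma3 (d : ℕ) (k : ℕ∞) (hdk : (d : ℕ∞) < k) :
    ∃ ρ : ℝ, (∀ x : ℝ, RLL.IsPosRoot d k x ↔ x = ρ) ∧
      Summable (fun i : RLL.parts d k => ((i : ℕ) : ℝ) * ρ ^ (i : ℕ)) ∧
      (∀ j : ℕ, d ≤ j → (j : ℕ∞) ≤ k →
        (∀ W l : ℕ → ℕ, RLL.IsRounding W (RLL.wStar d k ρ) →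
          RLL.IsRounding l (RLL.lamStar d k ρ j) →
          (∀ᶠ n in Filter.atTop, RLL.SRuns d k j n (W n) (l n) ≠ 0) →
          RLL.SimExp (fun n => (RLL.S d k n : ℝ))
            (fun n => (RLL.SRuns d k j n (W n) (l n) : ℝ))) ∧
        (∃ W l : ℕ → ℕ, RLL.IsRounding W (RLL.wStar d k ρ) ∧
          RLL.IsRounding l (RLL.lamStar d k ρ j) ∧
          ∀ᶠ n in Filter.atTop, RLL.SRuns d k j n (W n) (l n) ≠ 0) ∧
        ((∃ i : ℕ, d ≤ i ∧ ((i + 1 : ℕ) : ℕ∞) ≤ k ∧ i ≠ j ∧ i + 1 ≠ j) →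
          ∀ W l : ℕ → ℕ, RLL.IsRounding W (RLL.wStar d k ρ) →
            RLL.IsRounding l (RLL.lamStar d k ρ j) →
            ∀ᶠ n in Filter.atTop, RLL.SRuns d k j n (W n) (l n) ≠ 0)) ∧
      ∃ f : ℕ → ℝ, f =o[Filter.atTop] (fun n : ℕ => (n : ℝ)) ∧
        ∀ j : ℕ, d ≤ j → (j : ℕ∞) ≤ k →
          RLL.LessSim
            (fun n => (RLL.S d k n : ℝ) -
              (RLL.typicalCount d k j n (RLL.wStar d k ρ) (RLL.lamStar d k ρ j) (f n) : ℝ))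
            (fun n => (RLL.S d k n : ℝ) / (n : ℝ) ^ (Real.logb 2 (n : ℝ))) := by
  obtain ⟨ρ, hρ⟩ := RLL.exists_isPosRoot hdk
  have hne : ∀ {j : ℕ} {W l : ℕ → ℕ}, (∀ η < -Real.log ρ, ∀ᶠ n : ℕ in Filter.atTop,
      Real.exp (η * n) ≤ RLL.SRuns d k j n (W n) (l n)) →
      ∀ᶠ n in Filter.atTop, RLL.SRuns d k j n (W n) (l n) ≠ 0 := fun h => by
    filter_upwards [h (-Real.log ρ - 1) (by linarith)] with n hn h0
    rw [h0, Nat.cast_zero] at hn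
    exact absurd hn (not_le.2 (Real.exp_pos _))
  refine ⟨ρ, fun x => ⟨fun hx => hx.unique hdk hρ, fun hx => hx ▸ hρ⟩, ?_, ?_, ?_⟩
  · exact summable_subtype_iff_indicator.2 (hρ.summable_mul hdk)
  · intro j hdj hjk
    have hj := RLL.succ_mem_parts.2 ⟨hdj, hjk⟩
    refine ⟨fun W l hW hl h => RLL.simExp_of_exp_le hdk hρ fun η hη =>
      RLL.eventually_exp_le_SRuns_of_ne_zero hdk hρ hj hW hl h hη, ?_, ?_⟩
    · obtain ⟨W, l, hW, hl, h⟩ := RLL.exists_rounding hdk hρ hj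
      exact ⟨W, l, hW, hl, hne h⟩
    · rintro ⟨i, hdi, hik, hij, hij'⟩ W l hW hl
      refine hne fun η hη => RLL.eventually_exp_le_SRuns_of_consecutive hdk hρ (a := i + 1)
        (RLL.succ_mem_parts.2 ⟨hdi, le_trans (by exact_mod_cast i.le_succ) hik⟩)
        (RLL.succ_mem_parts.2 ⟨by omega, hik⟩) hj (by omega) (by omega) hW hl hη
  -- Level `m` asks for deviation `n / (m+1)` for all `j ≤ m` at once, so a single `f` serves every
  -- `j` even when `k = ∞`.
  · obtain ⟨g, hg, hA⟩ := RLL.exists_diagonal (A := fun m n => ∀ j ∈ Finset.range (m + 1),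
      d ≤ j → (j : ℕ∞) ≤ k → (RLL.S d k n : ℝ) - RLL.typicalCount d k j n (RLL.wStar d k ρ)
        (RLL.lamStar d k ρ j) (1 / ((m : ℝ) + 1) * n) ≤
          RLL.S d k n / (n : ℝ) ^ Real.logb 2 n) fun m => by
      rw [Finset.eventually_all]
      intro j _
      by_cases h : d ≤ j ∧ (j : ℕ∞) ≤ k
      · filter_upwards [RLL.eventually_S_sub_typicalCount_le hdk hρ (RLL.succ_mem_parts.2 h)
          (ε := 1 / ((m : ℝ) + 1)) (by positivity)] with n hn _ _ using hn
      · exact Filter.Eventually.of_forall fun n h1 h2 => absurd ⟨h1, h2⟩ h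
    refine ⟨fun n => 1 / ((g n : ℝ) + 1) * n, ?_, fun j hdj hjk ε hε => ?_⟩
    · have h0 : Filter.Tendsto (fun n => 1 / ((g n : ℝ) + 1)) Filter.atTop (nhds 0) :=
        tendsto_one_div_add_atTop_nhds_zero_nat.comp hg
      simpa using ((Asymptotics.isLittleO_one_iff ℝ).2 h0).mul_isBigO
        (Asymptotics.isBigO_refl (fun n : ℕ => (n : ℝ)) Filter.atTop)
    · filter_upwards [hA, hg.eventually_ge_atTop j] with n h1 h2
      refine le_trans ?_ (h1 j (Finset.mem_range.2 (by omega)) hdj hjk)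
      have h3 : (RLL.typicalCount d k j n (RLL.wStar d k ρ) (RLL.lamStar d k ρ j)
          (1 / ((g n : ℝ) + 1) * n) : ℝ) ≤ RLL.S d k n :=
        Nat.cast_le.2 (RLL.typicalCount_le_S d k j n _ _ _)
      nlinarith [mul_nonneg hε.le (sub_nonneg.2 h3)]
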